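/- **Setting.** A stochastic instance of repeated bilateral trade is a probability distribution $P$ on $[0,1]^2$. In each round $t=1,\dots,T$ valuations $(s_t,b_t)\sim P$ of a seller and a buyer are drawn independently, and a learner posts prices $(p_t,q_t)\in[0,1]^2$. Under two-bit feedback the learner then observes only $\mathbb I\{s_t\le p_t\}$ and $\mathbb I\{q_t\le b_t\}$; an algorithm chooses $(p_t,q_t)$ as a (measurable) function of the past feedback and of an internal random seed independent of the valuations. Put $$\mathrm{GFT}_P(p,q)=\mathbb E_{(s,b)\sim P}\big[(b-s)\,\mathbb I\{s\le p,\ q\le b\}\big],\qquad \mathrm{Rev}_P(p,q)=\mathbb E_{(s,b)\sim P}\big[(q-p)\,\mathbb I\{s\le p,\ q\le b\}\big],$$ and define the pseudo-regret and the pseudo-violation $$\mathcal R_T(P)=T\sup_{p\in[0,1]}\mathrm{GFT}_P(p,p)-\sum_{t=1}^T\mathrm{GFT}_P(p_t,q_t),\qquad \mathcal V_T(P)=-\sum_{t=1}^T\mathrm{Rev}_P(p_t,q_t).$$ **The family.** Let $\ell=\tfrac18$. For an integer $N\ge 2$ and $g,\varepsilon>0$ let $x_i=\tfrac{1-\ell}2+\tfrac{i\,\ell}{N}$,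 $\gamma_1=\tfrac{g}{4(N+1)}$, $\gamma_5=\tfrac12$, $\gamma_6=\tfrac14\big(1-4(N+1)\gamma_1-\gamma_5\big)$. The unperturbed distribution $\mu_0$ gives, for each $i=0,\dots,N$, the masses $$\gamma_1\Big(1+\tfrac{2i}{3N}\Big),\quad \gamma_1\Big(1-\tfrac{2i}{3N}\Big),\quad \gamma_1\Big(1+\tfrac{2(N-i)}{3N}\Big),\quad \gamma_1\Big(1-\tfrac{2(N-i)}{3N}\Big)$$ to the points $w_1^i=(x_i,1)$, $w_2^i=(x_i,1-3\ell)$, $w_3^i=(0,x_i)$, $w_4^i=(3\ell,x_i)$ respectively, the mass $\gamma_5$ to $\big(\tfrac{1-\ell}2,\tfrac{1+\ell}2\big)$, and the mass $\gamma_6$ to each of $(0,0),(0,1),(1,0),(1,1)$. For $1\le k\le N-1$, $\mu_k$ is obtained from $\mu_0$ by adding $\varepsilon$ to the masses of $w_1^k,\,w_2^{k+1},\,w_3^k,\,w_4^{k+1}$ and subtracting $\varepsilon$ from those of $w_1^{k+1},\,w_2^k,\,w_3^{k+1},\,w_4^k$. **Theorem.** There are absolute constants $c,a_N,a_g>0$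 and $T_0$ such that the following holds for every $\beta\in[\tfrac34,\tfrac67]$ and every horizon $T\ge T_0$. With $N=\lfloor a_N T^{1-\beta}\rfloor$, $g=a_g T^{1-\frac43\beta}$ and $\varepsilon=\gamma_1/3$, one has $N\ge2$ and $\varepsilon>0$, the $\mu_0,\dots,\mu_{N-1}$ are probability distributions on $[0,1]^2$, and every (randomized) algorithm under two-bit feedback, possibly tuned to $T$ and $\beta$, that guarantees $\mathbb E[\mathcal V_T(P)]\le T^\beta$ on every stochastic instance $P$ (in particular every algorithm that guarantees $\mathcal V_T\le T^\beta$ almost surely) satisfies $$\mathbb E[\mathcal R_T(\mu_k)]\ \ge\ c\,T^{1-\beta/3}\qquad\text{for some } k\in\{0,\dots,N-1\}.$$ -/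

import Mathlib

open MeasureTheory

noncomputable section

namespace BilateralTrade

/-- A stochastic instance: the joint law of the valuations `(s, b)` of seller and buyer,
a probability distribution carried by `[0,1]²`. -/
structure StochasticInstance where
  law : Measure (ℝ × ℝ)
  isProbabilityMeasure : IsProbabilityMeasure law
  law_compl : law (Set.Icc 0 1 ×ˢ Set.Icc 0 1)ᶜ = 0

attribute [instance] StochasticInstance.isProbabilityMeasure

/-- Gain from trade when the valuations are `v = (s, b)` and the price `p` is posted to the
seller, `q` to the buyer. -/
def gft (p q : ℝ) (v : ℝ × ℝ) : ℝ :=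
  if v.1 ≤ p ∧ q ≤ v.2 then v.2 - v.1 else 0

/-- Revenue when the valuations are `v = (s, b)` and the price `p` is posted to the seller,
`q` to the buyer. -/
def rev (p q : ℝ) (v : ℝ × ℝ) : ℝ :=
  if v.1 ≤ p ∧ q ≤ v.2 then q - p else 0

/-- Expected gain from trade of the pair of prices `(p, q)`. -/
def expGFT (P : StochasticInstance) (p q : ℝ) : ℝ := ∫ v, gft p q v ∂P.law

/-- Expected revenue of the pair of prices `(p, q)`. -/
def expRev (P : StochasticInstance) (p q : ℝ) : ℝ := ∫ v, rev p q v ∂P.law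

/-- A pair of prices `(p, q)`: `p` for the seller, `q` for the buyer. -/
abbrev Prices : Type := unitInterval × unitInterval

/-- The two bits revealed at the end of a round: whether the seller accepts and whether the
buyer accepts. -/
def feedback (x : Prices) (v : ℝ × ℝ) : Bool × Bool :=
  (decide (v.1 ≤ (x.1 : ℝ)), decide ((x.2 : ℝ) ≤ v.2))

/-- A randomized learning algorithm under two-bit feedback. The pair of prices of a round is a
function of an internal random seed and of the feedback of all earlier rounds (as a list, most
recent round first); its own earlier prices are determined by the same data. -/
structure Algorithm (Seed : Type*) [MeasurableSpace Seed] where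
  price : List (Bool × Bool) → Seed → Prices
  measurable_price : ∀ h, Measurable (price h)

variable {Seed : Type*} [MeasurableSpace Seed]

/-- The feedback received in the first `t` rounds (most recent first), for the seed `u` and the
sequence `v` of valuations. -/
def Algorithm.history (A : Algorithm Seed) (u : Seed) (v : ℕ → ℝ × ℝ) : ℕ → List (Bool × Bool)
  | 0 => []
  | t + 1 => feedback (A.price (A.history u v t) u) (v t) :: A.history u v t

/-- The prices posted in round `t` (rounds are numbered from `0`). -/
def Algorithm.posted (A : Algorithm Seed) (u : Seed) (v : ℕ → ℝ × ℝ) (t : ℕ) : Prices :=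
  A.price (A.history u v t) u

/-- Pseudo-regret over the rounds `0, …, T - 1`, a random variable. -/
def Algorithm.pseudoRegret (A : Algorithm Seed) (P : StochasticInstance) (T : ℕ)
    (u : Seed) (v : ℕ → ℝ × ℝ) : ℝ :=
  T * (⨆ p : unitInterval, expGFT P p p)
    - ∑ t ∈ Finset.range T, expGFT P (A.posted u v t).1 (A.posted u v t).2

/-- Pseudo-violation of global budget balance over the rounds `0, …, T - 1`, a random
variable. -/
def Algorithm.pseudoViolation (A : Algorithm Seed) (P : StochasticInstance) (T : ℕ)
    (u : Seed) (v : ℕ → ℝ × ℝ) : ℝ :=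
  - ∑ t ∈ Finset.range T, expRev P (A.posted u v t).1 (A.posted u v t).2

/-- The probability space of the interaction: the seed has law `ν`, and the valuations are
i.i.d. with law `P.law` and independent of the seed. -/
def interactionLaw (ν : Measure Seed) (P : StochasticInstance) :
    Measure (Seed × (ℕ → ℝ × ℝ)) :=
  ν.prod (Measure.infinitePi fun _ : ℕ => P.law)

/-- Expected pseudo-regret. -/
def Algorithm.regret (A : Algorithm Seed) (ν : Measure Seed) (P : StochasticInstance)
    (T : ℕ) : ℝ :=
  ∫ ω, A.pseudoRegret P T ω.1 ω.2 ∂(interactionLaw ν P)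

/-- Expected pseudo-violation. -/
def Algorithm.violation (A : Algorithm Seed) (ν : Measure Seed) (P : StochasticInstance)
    (T : ℕ) : ℝ :=
  ∫ ω, A.pseudoViolation P T ω.1 ω.2 ∂(interactionLaw ν P)

/-! The double apple-tasting family, with `N` the number of instances, `g` the total mass of the
two apple-tasting gadgets and `ε` the size of the perturbation. -/

/-- The width of the grid of candidate prices. -/
def ell : ℝ := 1 / 8

/-- The grid point `(1 - ℓ) / 2 + i Δ`, with `Δ = ℓ / N`. -/
def grid (N i : ℕ) : ℝ := (1 - ell) / 2 + i * (ell / N)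

def gamma1 (N : ℕ) (g : ℝ) : ℝ := g / (4 * (N + 1))

def gamma5 : ℝ := 1 / 2

/-- The mass of each corner of the unit square. The four rows of the gadgets have total mass
`4 (N + 1) γ₁` in the unperturbed instance (and in every perturbed one). -/
def gamma6 (N : ℕ) (g : ℝ) : ℝ := (1 - 4 * (N + 1) * gamma1 N g - gamma5) / 4

/-- The perturbation of the `k`-th instance: `+ε` at `i = k` and `-ε` at `i = k + 1`; none for
`k = 0`. -/
def perturb (ε : ℝ) (k i : ℕ) : ℝ :=
  if k = 0 then 0 else if i = k then ε else if i = k + 1 then -ε else 0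

/-- A point mass of real weight `w`. -/
def atom (w : ℝ) (x : ℝ × ℝ) : Measure (ℝ × ℝ) := ENNReal.ofReal w • Measure.dirac x

/-- The distribution `μ_k`. -/
def hardLaw (N : ℕ) (g ε : ℝ) (k : ℕ) : Measure (ℝ × ℝ) :=
  (∑ i ∈ Finset.range (N + 1),
    (atom (gamma1 N g * (1 + 2 * i / (3 * N)) + perturb ε k i) (grid N i, 1)
      + atom (gamma1 N g * (1 - 2 * i / (3 * N)) - perturb ε k i) (grid N i, 1 - 3 * ell)
      + atom (gamma1 N g * (1 + 2 * (N - i) / (3 * N)) + perturb ε k i) (0, grid N i)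
      + atom (gamma1 N g * (1 - 2 * (N - i) / (3 * N)) - perturb ε k i) (3 * ell, grid N i)))
  + atom gamma5 ((1 - ell) / 2, (1 + ell) / 2)
  + (atom (gamma6 N g) (0, 0) + atom (gamma6 N g) (0, 1)
      + atom (gamma6 N g) (1, 0) + atom (gamma6 N g) (1, 1))

end BilateralTrade

end

/-!
The proof compares `μ_0` with the perturbed instances, by a Lagrangian bound and a change of measure.

*Lagrangian bound* (`expGFT_hardInstance_le`). Unless the central atom, of mass `1/2`, trades, a
constant is lost. If it trades, then every grid point accepted by one of the two prices is worth
`3 γ₁ / 4`, wherever it lies (`hardSum_gft`). A single price accepts at most `N + 2` of them, each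
further one needs prices that cross by one more grid step (`gridCount_le`), and there is one exchange
rate, of order `g`, at which all gain from trade above the best single price has to be bought by budget
violation (`gridCount_add_exchangeRate_mul_le`). A violation of `T ^ β` is therefore worth only
`O(g T ^ β) = O(T ^ (1 - β / 3))`, and apart from that the regret is at least a constant times the
number of exploration rounds, plus, under `μ_k`, `γ₁ / 8` per round in which the seller's price is not
in the `k`-th cell `[x_k, x_{k+1})`.

*Change of measure* (`Algorithm.meanTotal_le_of_distinguishable`). The perturbation is invisible in
both marginals, so the two bits have different laws under `μ_0` and `μ_k` only at the prices of
`infoSet N k`; these are exploration prices, the sets are disjoint for different `k`, and there the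
`χ²`-divergence is at most `64 ε²` because the corner atoms give all four feedbacks mass at least `1/16`
(`distinguishable_hardInstance`). Pinsker's inequality is replaced by the linear inequality
`L (1 - z) ≥ 2 + 2 log L - 2 z - L`, applied to the likelihood ratio `L` of the feedback history and
integrated under `μ_0`. The expectation of `log L` is a sum over the rounds, hence bounded by `ε²` times
the number of informative rounds under `μ_0`.

If there are fewer than `T ^ (1 - β / 3)` exploration rounds under `μ_0`, up to a constant, then
averaging over `k` gives a `k` whose cell is visited in at most half of the rounds under `μ_k`
(`Algorithm.exists_meanTotal_cellSet_le`), and the regret under `μ_k` is at least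
`γ₁ T / 16 - O(g T ^ β)`. The first term dominates because `γ₁ T` is of order
`g T ^ β · T ^ (1 - β) / N`, and `N` is a small multiple of `T ^ (1 - β)`.
-/

noncomputable section

namespace BilateralTrade

/-! ### The law of the feedback history -/

section Interaction

variable {Seed : Type*} [MeasurableSpace Seed]

/-- Feedback histories form a countable set, so they carry the discrete σ-algebra. -/
local instance : MeasurableSpace (List (Bool × Bool)) := ⊤

local instance : DiscreteMeasurableSpace (List (Bool × Bool)) := ⟨fun _ => trivial⟩

lemma measurable_feedback : Measurable fun z : Prices × (ℝ × ℝ) => feedback z.1 z.2 := by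
  unfold feedback
  refine Measurable.prodMk ?_ ?_
  · refine measurable_to_bool ?_
    have : (fun z : Prices × (ℝ × ℝ) => decide (z.2.1 ≤ (z.1.1 : ℝ))) ⁻¹' {true}
        = {z | z.2.1 ≤ (z.1.1 : ℝ)} := by ext; simp
    rw [this]
    exact measurableSet_le (by fun_prop) (by fun_prop)
  · refine measurable_to_bool ?_
    have : (fun z : Prices × (ℝ × ℝ) => decide ((z.1.2 : ℝ) ≤ z.2.2)) ⁻¹' {true}
        = {z | (z.1.2 : ℝ) ≤ z.2.2} := by ext; simp
    rw [this]
    exact measurableSet_le (by fun_prop) (by fun_prop)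

lemma Algorithm.measurable_price_uncurry (A : Algorithm Seed) :
    Measurable fun z : List (Bool × Bool) × Seed => A.price z.1 z.2 :=
  measurable_from_prod_countable_right A.measurable_price

lemma Algorithm.measurable_history (A : Algorithm Seed) (t : ℕ) :
    Measurable fun ω : Seed × (ℕ → ℝ × ℝ) => A.history ω.1 ω.2 t := by
  induction t with
  | zero => exact measurable_const
  | succ t ih =>
    have h1 : Measurable fun ω : Seed × (ℕ → ℝ × ℝ) =>
        (feedback (A.price (A.history ω.1 ω.2 t) ω.1) (ω.2 t), A.history ω.1 ω.2 t) :=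
      (measurable_feedback.comp
        ((A.measurable_price_uncurry.comp (ih.prodMk measurable_fst)).prodMk (by fun_prop))).prodMk
        ih
    have h2 : Measurable fun z : (Bool × Bool) × List (Bool × Bool) => z.1 :: z.2 :=
      measurable_of_countable _
    exact h2.comp h1

lemma Algorithm.measurable_posted (A : Algorithm Seed) (t : ℕ) :
    Measurable fun ω : Seed × (ℕ → ℝ × ℝ) => A.posted ω.1 ω.2 t :=
  A.measurable_price_uncurry.comp ((A.measurable_history t).prodMk measurable_fst)

lemma Algorithm.length_history (A : Algorithm Seed) (u : Seed) (v : ℕ → ℝ × ℝ) (t : ℕ) :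
    (A.history u v t).length = t := by
  induction t with
  | zero => rfl
  | succ t ih => simp [Algorithm.history, ih]

lemma Algorithm.history_congr (A : Algorithm Seed) (u : Seed) {v w : ℕ → ℝ × ℝ} (t : ℕ)
    (h : ∀ s < t, v s = w s) : A.history u v t = A.history u w t := by
  induction t with
  | zero => rfl
  | succ t ih =>
    simp only [Algorithm.history]
    rw [ih fun s hs => h s (by omega), h t (by omega)]

/-- The probability of receiving the feedback `o` at the prices `x`. -/
def fbProb (P : StochasticInstance) (x : Prices) (o : Bool × Bool) : ℝ :=
  ∫ v, (if feedback x v = o then 1 else 0) ∂P.law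

lemma integral_feedback (P : StochasticInstance) (x : Prices) (F : Bool × Bool → ℝ) :
    ∫ v, F (feedback x v) ∂P.law = ∑ o, fbProb P x o * F o := by
  have hm : Measurable fun v => feedback x v :=
    measurable_feedback.comp (measurable_const.prodMk measurable_id)
  have h : ∀ v, F (feedback x v) = ∑ o, (if feedback x v = o then 1 else 0) * F o := by
    intro v
    simp
  simp_rw [h, fbProb]
  rw [integral_finsetSum]
  · simp_rw [integral_mul_const]
  · intro o _
    refine Integrable.mul_const ?_ _
    refine Integrable.of_bound (C := 1) ?_ ?_
    · exact (Measurable.ite (hm (measurableSet_singleton o)) measurable_const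
        measurable_const).aestronglyMeasurable
    · refine Filter.Eventually.of_forall fun v => ?_
      split_ifs <;> simp

lemma fbProb_nonneg (P : StochasticInstance) (x : Prices) (o : Bool × Bool) :
    0 ≤ fbProb P x o :=
  integral_nonneg fun v => by split_ifs <;> simp

lemma sum_fbProb (P : StochasticInstance) (x : Prices) : ∑ o, fbProb P x o = 1 := by
  have := integral_feedback P x (fun _ => 1)
  simpa using this.symm

/-- The expectation of a function of the history of the first `t` rounds, for a fixed seed `u`,
as an iterated finite sum over the possible feedbacks. -/
def Algorithm.histMean (A : Algorithm Seed) (P : StochasticInstance) (u : Seed) :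
    ℕ → (List (Bool × Bool) → ℝ) → ℝ
  | 0, Φ => Φ []
  | t + 1, Φ => A.histMean P u t fun h => ∑ o, fbProb P (A.price h u) o * Φ (o :: h)

/-- The history of the first `t` rounds is independent of the valuations of round `t`. -/
lemma Algorithm.indepFun_history (A : Algorithm Seed) (P : StochasticInstance) (u : Seed) (t : ℕ) :
    ProbabilityTheory.IndepFun (fun v : ℕ → ℝ × ℝ => A.history u v t) (fun v => v t)
      (Measure.infinitePi fun _ : ℕ => P.law) := by
  have hi : ProbabilityTheory.iIndepFun (fun (i : ℕ) (ω : ℕ → ℝ × ℝ) => ω i)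
      (Measure.infinitePi fun _ : ℕ => P.law) :=
    ProbabilityTheory.iIndepFun_infinitePi (X := fun _ x => x) (fun _ => measurable_id)
  have h2 := hi.indepFun_finset (Finset.range t) {t} (by simp) (fun i => measurable_pi_apply i)
  let ext : (Finset.range t → ℝ × ℝ) → ℕ → ℝ × ℝ :=
    fun w s => if hs : s ∈ Finset.range t then w ⟨s, hs⟩ else 0
  have hext : Measurable ext := by
    refine measurable_pi_iff.2 fun s => ?_
    by_cases hs : s ∈ Finset.range t
    · simp only [ext, dif_pos hs]
      exact measurable_pi_apply _
    · simp only [ext, dif_neg hs]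
      exact measurable_const
  have hG : Measurable fun w : Finset.range t → ℝ × ℝ => A.history u (ext w) t :=
    (A.measurable_history t).comp (measurable_const.prodMk hext)
  have hE : Measurable fun w : ({t} : Finset ℕ) → ℝ × ℝ => w ⟨t, by simp⟩ :=
    measurable_pi_apply _
  have h3 := h2.comp hG hE
  have h4 : (fun v : ℕ → ℝ × ℝ => A.history u v t)
      = (fun w : Finset.range t → ℝ × ℝ => A.history u (ext w) t) ∘ fun v i => v i := by
    funext v
    exact A.history_congr u t fun s hs => by simp [ext, hs]
  rw [h4]
  exact h3

/-- For a fixed seed the feedback history is a finite Markov chain with transition probabilities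
`fbProb`. -/
lemma Algorithm.integral_history (A : Algorithm Seed) (P : StochasticInstance) (u : Seed) (t : ℕ)
    (Φ : List (Bool × Bool) → ℝ) :
    ∫ v, Φ (A.history u v t) ∂(Measure.infinitePi fun _ : ℕ => P.law) = A.histMean P u t Φ := by
  induction t generalizing Φ with
  | zero => simp [Algorithm.history, Algorithm.histMean]
  | succ t ih =>
    rw [Algorithm.histMean, ← ih]
    set μ := Measure.infinitePi fun _ : ℕ => P.law with hμ
    have hX : Measurable fun v : ℕ → ℝ × ℝ => A.history u v t :=
      (A.measurable_history t).comp (measurable_const.prodMk measurable_id)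
    have hY : Measurable fun v : ℕ → ℝ × ℝ => v t := measurable_pi_apply t
    have hmap : μ.map (fun v => (A.history u v t, v t))
        = (μ.map fun v => A.history u v t).prod P.law := by
      rw [(ProbabilityTheory.indepFun_iff_map_prod_eq_prod_map_map hX.aemeasurable
        hY.aemeasurable).1 (A.indepFun_history P u t), hμ, Measure.infinitePi_map_eval]
    let Ψ : List (Bool × Bool) × (ℝ × ℝ) → ℝ :=
      fun z => Φ (feedback (A.price z.1 u) z.2 :: z.1)
    have hΨ : Measurable Ψ := by
      have h1 : Measurable fun z : List (Bool × Bool) × (ℝ × ℝ) =>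
          (feedback (A.price z.1 u) z.2, z.1) :=
        (measurable_feedback.comp ((A.measurable_price_uncurry.comp
          (measurable_fst.prodMk measurable_const)).prodMk measurable_snd)).prodMk measurable_fst
      have h2 : Measurable fun z : (Bool × Bool) × List (Bool × Bool) => Φ (z.1 :: z.2) :=
        measurable_of_countable _
      exact h2.comp h1
    -- `Φ` need not be bounded, but only the finitely many histories of length `t + 1` occur.
    obtain ⟨C, hC⟩ : ∃ C, ∀ h : List (Bool × Bool), h.length = t + 1 → ‖Φ h‖ ≤ C := by
      have hf : {h : List (Bool × Bool) | h.length = t + 1}.Finite := List.finite_length_eq _ _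
      obtain ⟨C, hC⟩ := (hf.image fun h => ‖Φ h‖).bddAbove
      exact ⟨C, fun h hh => hC ⟨h, hh, rfl⟩⟩
    have hint : Integrable Ψ ((μ.map fun v => A.history u v t).prod P.law) := by
      rw [← hmap, integrable_map_measure hΨ.aestronglyMeasurable (hX.prodMk hY).aemeasurable]
      refine Integrable.of_bound (C := C) (hΨ.comp (hX.prodMk hY)).aestronglyMeasurable ?_
      exact Filter.Eventually.of_forall fun v => hC _ (by simp [A.length_history])
    calc ∫ v, Φ (A.history u v (t + 1)) ∂μ
        = ∫ v, Ψ (A.history u v t, v t) ∂μ := rfl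
      _ = ∫ z, Ψ z ∂(μ.map fun v => (A.history u v t, v t)) :=
          (integral_map (hX.prodMk hY).aemeasurable hΨ.aestronglyMeasurable).symm
      _ = ∫ h, ∫ y, Ψ (h, y) ∂P.law ∂(μ.map fun v => A.history u v t) := by
          rw [hmap, integral_prod _ hint]
      _ = ∫ h, ∑ o, fbProb P (A.price h u) o * Φ (o :: h) ∂(μ.map fun v => A.history u v t) := by
          congr 1
          funext h
          exact integral_feedback P (A.price h u) fun o => Φ (o :: h)
      _ = _ := integral_map hX.aemeasurable (measurable_of_countable _).aestronglyMeasurable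

lemma Algorithm.histMean_mono (A : Algorithm Seed) (P : StochasticInstance) (u : Seed) (t : ℕ)
    {Φ Ψ : List (Bool × Bool) → ℝ} (h : ∀ l, l.length = t → Φ l ≤ Ψ l) :
    A.histMean P u t Φ ≤ A.histMean P u t Ψ := by
  induction t generalizing Φ Ψ with
  | zero => exact h [] rfl
  | succ t ih =>
    refine ih fun l hl => Finset.sum_le_sum fun o _ => ?_
    exact mul_le_mul_of_nonneg_left (h _ (by simp [hl])) (fbProb_nonneg _ _ _)

lemma Algorithm.histMean_add (A : Algorithm Seed) (P : StochasticInstance) (u : Seed) (t : ℕ)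
    (Φ Ψ : List (Bool × Bool) → ℝ) :
    A.histMean P u t (fun l => Φ l + Ψ l) = A.histMean P u t Φ + A.histMean P u t Ψ := by
  induction t generalizing Φ Ψ with
  | zero => rfl
  | succ t ih =>
    simp only [Algorithm.histMean, mul_add, Finset.sum_add_distrib]
    exact ih _ _

lemma Algorithm.histMean_const_mul (A : Algorithm Seed) (P : StochasticInstance) (u : Seed) (t : ℕ)
    (c : ℝ) (Φ : List (Bool × Bool) → ℝ) :
    A.histMean P u t (fun l => c * Φ l) = c * A.histMean P u t Φ := by
  induction t generalizing Φ with
  | zero => rfl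
  | succ t ih =>
    simp only [Algorithm.histMean]
    rw [← ih]
    congr 1
    funext l
    rw [Finset.mul_sum]
    exact Finset.sum_congr rfl fun o _ => by ring

lemma Algorithm.histMean_const (A : Algorithm Seed) (P : StochasticInstance) (u : Seed) (t : ℕ)
    (c : ℝ) : A.histMean P u t (fun _ => c) = c := by
  induction t with
  | zero => rfl
  | succ t ih =>
    simp only [Algorithm.histMean, ← Finset.sum_mul, sum_fbProb, one_mul]
    exact ih

/-! ### Change of measure -/

/-- The sum of `φ` over the prices posted before the history `h` was completed, as a function of
the history. -/
def Algorithm.cumul (A : Algorithm Seed) (u : Seed) (φ : Prices → ℝ) : List (Bool × Bool) → ℝ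
  | [] => 0
  | _ :: h => A.cumul u φ h + φ (A.price h u)

lemma Algorithm.cumul_history (A : Algorithm Seed) (u : Seed) (φ : Prices → ℝ) (v : ℕ → ℝ × ℝ)
    (t : ℕ) : A.cumul u φ (A.history u v t) = ∑ s ∈ Finset.range t, φ (A.posted u v s) := by
  induction t with
  | zero => rfl
  | succ t ih =>
    rw [Finset.sum_range_succ, ← ih]
    rfl

lemma Algorithm.cumul_mem_Icc (A : Algorithm Seed) (u : Seed) {φ : Prices → ℝ}
    (hφ : ∀ x, φ x ∈ Set.Icc (0 : ℝ) 1) (h : List (Bool × Bool)) :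
    A.cumul u φ h ∈ Set.Icc (0 : ℝ) h.length := by
  induction h with
  | nil => simp [Algorithm.cumul]
  | cons o h ih =>
    have := hφ (A.price h u)
    simp only [Algorithm.cumul, List.length_cons, Nat.cast_add, Nat.cast_one, Set.mem_Icc] at *
    constructor <;> linarith

open Classical in
/-- The one-round likelihood ratio of `Q` to `P`, set to `1` at prices outside `I`, where the two
instances give the same feedback. -/
def fbRatio (P Q : StochasticInstance) (I : Set Prices) (x : Prices) (o : Bool × Bool) : ℝ :=
  if x ∈ I then fbProb Q x o / fbProb P x o else 1

/-- The likelihood ratio of `Q` to `P` of a feedback history. -/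
def Algorithm.likelihood (A : Algorithm Seed) (P Q : StochasticInstance) (I : Set Prices)
    (u : Seed) : List (Bool × Bool) → ℝ
  | [] => 1
  | o :: h => A.likelihood P Q I u h * fbRatio P Q I (A.price h u) o

/-- `P` and `Q` give the same feedback at prices outside `I`; at prices in `I` every feedback has
positive probability, and the `χ²`-divergence of the feedback is at most `κ`. -/
structure Distinguishable (P Q : StochasticInstance) (I : Set Prices) (κ : ℝ) : Prop where
  eq_of_notMem : ∀ x ∉ I, ∀ o, fbProb P x o = fbProb Q x o
  pos_left : ∀ x ∈ I, ∀ o, 0 < fbProb P x o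
  pos_right : ∀ x ∈ I, ∀ o, 0 < fbProb Q x o
  chiSq_le : ∀ x ∈ I, ∑ o, (fbProb P x o - fbProb Q x o) ^ 2 / fbProb Q x o ≤ κ

namespace Distinguishable

variable {P Q : StochasticInstance} {I : Set Prices} {κ : ℝ}

lemma fbRatio_pos (H : Distinguishable P Q I κ) (x : Prices) (o : Bool × Bool) :
    0 < fbRatio P Q I x o := by
  unfold fbRatio
  split_ifs with hx
  · exact div_pos (H.pos_right x hx o) (H.pos_left x hx o)
  · exact one_pos

lemma fbProb_mul_fbRatio (H : Distinguishable P Q I κ) (x : Prices) (o : Bool × Bool) :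
    fbProb P x o * fbRatio P Q I x o = fbProb Q x o := by
  unfold fbRatio
  split_ifs with hx
  · rw [mul_div_cancel₀ _ (H.pos_left x hx o).ne']
  · rw [mul_one, H.eq_of_notMem x hx]

/-- The relative entropy of the feedback is at most its `χ²`-divergence. -/
lemma sum_fbProb_mul_log_ge (H : Distinguishable P Q I κ) (x : Prices) :
    -(κ * I.indicator 1 x) ≤ ∑ o, fbProb P x o * Real.log (fbRatio P Q I x o) := by
  by_cases hx : x ∈ I
  · have h1 : ∀ o, (fbProb Q x o - fbProb P x o)
        - (fbProb P x o - fbProb Q x o) ^ 2 / fbProb Q x o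
        ≤ fbProb P x o * Real.log (fbRatio P Q I x o) := by
      intro o
      have hp := H.pos_left x hx o
      have hq := H.pos_right x hx o
      have hl := Real.one_sub_inv_le_log_of_pos (H.fbRatio_pos x o)
      have : (fbProb Q x o - fbProb P x o)
        - (fbProb P x o - fbProb Q x o) ^ 2 / fbProb Q x o
        = fbProb P x o * (1 - (fbRatio P Q I x o)⁻¹) := by
        simp only [fbRatio, if_pos hx]
        field_simp
        ring
      rw [this]
      exact mul_le_mul_of_nonneg_left hl hp.le
    have h2 := Finset.sum_le_sum fun o (_ : o ∈ Finset.univ) => h1 o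
    have h3 := H.chiSq_le x hx
    rw [Finset.sum_sub_distrib, Finset.sum_sub_distrib, sum_fbProb, sum_fbProb] at h2
    simp only [Set.indicator_of_mem hx, Pi.one_apply]
    linarith
  · simp [fbRatio, hx]

lemma likelihood_pos (H : Distinguishable P Q I κ) (A : Algorithm Seed) (u : Seed)
    (h : List (Bool × Bool)) : 0 < A.likelihood P Q I u h := by
  induction h with
  | nil => exact one_pos
  | cons o h ih => exact mul_pos ih (H.fbRatio_pos _ _)

/-- Expectations under `Q` are expectations under `P` weighted by the likelihood ratio. -/
lemma histMean_likelihood_mul (H : Distinguishable P Q I κ) (A : Algorithm Seed) (u : Seed)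
    (t : ℕ) (Φ : List (Bool × Bool) → ℝ) :
    A.histMean P u t (fun h => A.likelihood P Q I u h * Φ h) = A.histMean Q u t Φ := by
  induction t generalizing Φ with
  | zero => simp [Algorithm.histMean, Algorithm.likelihood]
  | succ t ih =>
    simp only [Algorithm.histMean]
    rw [← ih]
    congr 1
    funext h
    rw [Finset.mul_sum]
    refine Finset.sum_congr rfl fun o _ => ?_
    rw [← H.fbProb_mul_fbRatio, Algorithm.likelihood]
    ring

/-- The chain rule for the relative entropy: only the rounds with prices in `I` contribute. -/
lemma histMean_log_likelihood_ge (H : Distinguishable P Q I κ) (A : Algorithm Seed) (u : Seed)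
    (t : ℕ) :
    -(κ * A.histMean P u t (A.cumul u (I.indicator 1)))
      ≤ A.histMean P u t (fun h => Real.log (A.likelihood P Q I u h)) := by
  suffices h : 0 ≤ A.histMean P u t (fun h => Real.log (A.likelihood P Q I u h)
      + κ * A.cumul u (I.indicator 1) h) by
    rw [A.histMean_add, A.histMean_const_mul] at h
    linarith
  induction t with
  | zero => simp [Algorithm.histMean, Algorithm.likelihood, Algorithm.cumul]
  | succ t ih =>
    refine ih.trans (A.histMean_mono P u t fun h _ => ?_)
    have h1 := H.sum_fbProb_mul_log_ge (A.price h u)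
    have h2 : ∀ o, fbProb P (A.price h u) o * (Real.log (A.likelihood P Q I u (o :: h))
          + κ * A.cumul u (I.indicator 1) (o :: h))
        = fbProb P (A.price h u) o * (Real.log (A.likelihood P Q I u h)
          + κ * A.cumul u (I.indicator 1) h + κ * I.indicator 1 (A.price h u))
          + fbProb P (A.price h u) o * Real.log (fbRatio P Q I (A.price h u) o) := by
      intro o
      simp only [Algorithm.likelihood, Algorithm.cumul]
      rw [Real.log_mul (H.likelihood_pos A u h).ne' (H.fbRatio_pos _ _).ne']
      ring
    simp_rw [h2]
    rw [Finset.sum_add_distrib, ← Finset.sum_mul, sum_fbProb]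
    linarith

/-- The linear inequality `L (1 - z) ≥ 2 + 2 log L - 2 z - L` for `L > 0` and `0 ≤ z ≤ 1`,
integrated under `P` with `L` the likelihood ratio, bounds expectations under `Q`. -/
lemma histMean_le (H : Distinguishable P Q I κ) (A : Algorithm Seed) (u : Seed) (t : ℕ)
    {φ : Prices → ℝ} (hφ : ∀ x, φ x ∈ Set.Icc (0 : ℝ) 1) :
    A.histMean Q u t (A.cumul u φ) ≤ 2 * A.histMean P u t (A.cumul u φ)
      + 2 * κ * t * A.histMean P u t (A.cumul u (I.indicator 1)) := by
  have key : A.histMean P u t (fun h => A.likelihood P Q I u h * A.cumul u φ h)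
      ≤ A.histMean P u t (fun h => (2 * A.cumul u φ h
        + (-(2 * t)) * Real.log (A.likelihood P Q I u h))
        + ((2 * t) * (A.likelihood P Q I u h * 1) + (-(2 * t)))) := by
    refine A.histMean_mono P u t fun h hh => ?_
    obtain ⟨c0, c1⟩ := A.cumul_mem_Icc u hφ h
    have hL := H.likelihood_pos A u h
    rw [hh] at c1
    generalize A.cumul u φ h = c at *
    generalize A.likelihood P Q I u h = L at *
    -- The claim is affine in `c`: the two extreme cases are `log L ≤ L - 1` (for `c = 0`) and
    -- `2 log L ≤ L` (for `c = t`).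
    have l1 := Real.log_le_sub_one_of_pos hL
    have l2 : 2 * Real.log L ≤ L := by
      have h3 := Real.log_le_sub_one_of_pos (Real.sqrt_pos.2 hL)
      rw [Real.log_sqrt hL.le] at h3
      nlinarith [Real.sq_sqrt hL.le, sq_nonneg (Real.sqrt L - 2)]
    nlinarith [mul_nonneg (sub_nonneg.2 c1) (sub_nonneg.2 l1), mul_nonneg c0 (sub_nonneg.2 l2)]
  rw [H.histMean_likelihood_mul, A.histMean_add, A.histMean_add, A.histMean_add,
    A.histMean_const_mul, A.histMean_const_mul, A.histMean_const_mul,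
    H.histMean_likelihood_mul, A.histMean_const, A.histMean_const] at key
  have h1 := H.histMean_log_likelihood_ge A u t
  have h2 := mul_le_mul_of_nonneg_left h1 (show (0 : ℝ) ≤ 2 * t by positivity)
  linarith

end Distinguishable

/-! ### Expected totals over the horizon -/

/-- The expectation of the sum of `φ` over the prices posted in the first `T` rounds. -/
def Algorithm.meanTotal (A : Algorithm Seed) (ν : Measure Seed) (P : StochasticInstance) (T : ℕ)
    (φ : Prices → ℝ) : ℝ :=
  ∫ ω, ∑ t ∈ Finset.range T, φ (A.posted ω.1 ω.2 t) ∂(interactionLaw ν P)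

/-- Bounded measurable functions of the prices. -/
structure BddMeas (φ : Prices → ℝ) : Prop where
  measurable : Measurable φ
  bdd : ∃ C, ∀ x, |φ x| ≤ C

lemma bddMeas_const (c : ℝ) : BddMeas fun _ => c := ⟨measurable_const, |c|, fun _ => le_rfl⟩

lemma BddMeas.add {φ ψ : Prices → ℝ} (hφ : BddMeas φ) (hψ : BddMeas ψ) :
    BddMeas fun x => φ x + ψ x := by
  obtain ⟨C, hC⟩ := hφ.bdd
  obtain ⟨D, hD⟩ := hψ.bdd
  exact ⟨hφ.measurable.add hψ.measurable, C + D,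
    fun x => (abs_add_le _ _).trans (add_le_add (hC x) (hD x))⟩

lemma BddMeas.const_mul {φ : Prices → ℝ} (hφ : BddMeas φ) (c : ℝ) :
    BddMeas fun x => c * φ x := by
  obtain ⟨C, hC⟩ := hφ.bdd
  exact ⟨hφ.measurable.const_mul c, |c| * C, fun x => by
    rw [abs_mul]
    exact mul_le_mul_of_nonneg_left (hC x) (abs_nonneg c)⟩

lemma bddMeas_indicator {s : Set Prices} (hs : MeasurableSet s) :
    BddMeas (s.indicator (1 : Prices → ℝ)) := by
  refine ⟨measurable_one.indicator hs, 1, fun x => ?_⟩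
  by_cases hx : x ∈ s <;> simp [hx]

variable (A : Algorithm Seed) (ν : Measure Seed) (P : StochasticInstance) (T : ℕ)

lemma Algorithm.meanTotal_const_mul (c : ℝ) (φ : Prices → ℝ) :
    A.meanTotal ν P T (fun x => c * φ x) = c * A.meanTotal ν P T φ := by
  simp only [Algorithm.meanTotal, ← Finset.mul_sum]
  exact integral_const_mul _ _

variable [IsProbabilityMeasure ν]

local instance : IsProbabilityMeasure (interactionLaw ν P) := by
  unfold interactionLaw; infer_instance

lemma BddMeas.integrable {φ : Prices → ℝ} (hφ : BddMeas φ) (t : ℕ) :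
    Integrable (fun ω : Seed × (ℕ → ℝ × ℝ) => φ (A.posted ω.1 ω.2 t)) (interactionLaw ν P) := by
  obtain ⟨C, hC⟩ := hφ.bdd
  exact Integrable.of_bound (hφ.measurable.comp (A.measurable_posted t)).aestronglyMeasurable C
    (Filter.Eventually.of_forall fun ω => hC _)

lemma Algorithm.meanTotal_eq_sum {φ : Prices → ℝ} (hφ : BddMeas φ) :
    A.meanTotal ν P T φ
      = ∑ t ∈ Finset.range T, ∫ ω, φ (A.posted ω.1 ω.2 t) ∂(interactionLaw ν P) :=
  integral_finsetSum _ fun t _ => hφ.integrable A ν P t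

lemma Algorithm.meanTotal_mono {φ ψ : Prices → ℝ} (hφ : BddMeas φ) (hψ : BddMeas ψ)
    (h : ∀ x, φ x ≤ ψ x) : A.meanTotal ν P T φ ≤ A.meanTotal ν P T ψ := by
  rw [A.meanTotal_eq_sum ν P T hφ, A.meanTotal_eq_sum ν P T hψ]
  exact Finset.sum_le_sum fun t _ =>
    integral_mono (hφ.integrable A ν P t) (hψ.integrable A ν P t) fun ω => h _

lemma Algorithm.meanTotal_add {φ ψ : Prices → ℝ} (hφ : BddMeas φ) (hψ : BddMeas ψ) :
    A.meanTotal ν P T (fun x => φ x + ψ x) = A.meanTotal ν P T φ + A.meanTotal ν P T ψ := by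
  rw [A.meanTotal_eq_sum ν P T hφ, A.meanTotal_eq_sum ν P T hψ,
    A.meanTotal_eq_sum ν P T (hφ.add hψ), ← Finset.sum_add_distrib]
  exact Finset.sum_congr rfl fun t _ => integral_add (hφ.integrable A ν P t) (hψ.integrable A ν P t)

lemma Algorithm.meanTotal_const (c : ℝ) : A.meanTotal ν P T (fun _ => c) = T * c := by
  simp [Algorithm.meanTotal]

lemma Algorithm.sum_meanTotal_le {ι : Type*} (s : Finset ι) {φ : ι → Prices → ℝ} {ψ : Prices → ℝ}
    (hφ : ∀ i ∈ s, BddMeas (φ i)) (hψ : BddMeas ψ) (h : ∀ x, ∑ i ∈ s, φ i x ≤ ψ x) :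
    ∑ i ∈ s, A.meanTotal ν P T (φ i) ≤ A.meanTotal ν P T ψ := by
  rw [A.meanTotal_eq_sum ν P T hψ,
    Finset.sum_congr rfl fun i hi => A.meanTotal_eq_sum ν P T (hφ i hi), Finset.sum_comm]
  refine Finset.sum_le_sum fun t _ => ?_
  rw [← integral_finsetSum _ fun i hi => (hφ i hi).integrable A ν P t]
  exact integral_mono (integrable_finsetSum _ fun i hi => (hφ i hi).integrable A ν P t)
    (hψ.integrable A ν P t) fun ω => h _

lemma Algorithm.meanTotal_eq_integral_histMean {φ : Prices → ℝ} (hφ : BddMeas φ) :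
    Integrable (fun u => A.histMean P u T (A.cumul u φ)) ν ∧
      A.meanTotal ν P T φ = ∫ u, A.histMean P u T (A.cumul u φ) ∂ν := by
  have hi : Integrable (fun ω : Seed × (ℕ → ℝ × ℝ) =>
      ∑ t ∈ Finset.range T, φ (A.posted ω.1 ω.2 t)) (interactionLaw ν P) :=
    integrable_finsetSum _ fun t _ => hφ.integrable A ν P t
  have h : ∀ u, ∫ v, ∑ t ∈ Finset.range T, φ (A.posted u v t)
      ∂(Measure.infinitePi fun _ : ℕ => P.law) = A.histMean P u T (A.cumul u φ) := by
    intro u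
    simp_rw [← A.cumul_history]
    exact A.integral_history P u T _
  unfold interactionLaw at hi
  refine ⟨?_, ?_⟩
  · simp_rw [← h]
    exact hi.integral_prod_left
  · simp_rw [← h]
    exact integral_prod _ hi

/-- Under `Q` the prices can be distributed differently from under `P` only as far as
informative prices, those in `I`, are posted under `P`. -/
lemma Algorithm.meanTotal_le_of_distinguishable {P Q : StochasticInstance} {I : Set Prices} {κ : ℝ}
    (H : Distinguishable P Q I κ) (hI : MeasurableSet I) {φ : Prices → ℝ} (hm : Measurable φ)
    (hφ : ∀ x, φ x ∈ Set.Icc (0 : ℝ) 1) :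
    A.meanTotal ν Q T φ ≤ 2 * A.meanTotal ν P T φ
      + 2 * κ * T * A.meanTotal ν P T (I.indicator 1) := by
  have hb : BddMeas φ := ⟨hm, 1, fun x => abs_le.2 ⟨by linarith [(hφ x).1], (hφ x).2⟩⟩
  obtain ⟨i1, e1⟩ := A.meanTotal_eq_integral_histMean ν Q T hb
  obtain ⟨i2, e2⟩ := A.meanTotal_eq_integral_histMean ν P T hb
  obtain ⟨i3, e3⟩ := A.meanTotal_eq_integral_histMean ν P T (bddMeas_indicator hI)
  rw [e1, e2, e3, ← integral_const_mul, ← integral_const_mul,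
    ← integral_add (i2.const_mul _) (i3.const_mul _)]
  exact integral_mono i1 ((i2.const_mul _).add (i3.const_mul _)) fun u =>
    H.histMean_le A u T hφ

end Interaction

/-! ### The hard instances -/

lemma grid_eq (N i : ℕ) : grid N i = 7 / 16 + (i / N : ℝ) / 8 := by
  unfold grid ell
  ring

lemma grid_mono (N : ℕ) : Monotone (grid N) := by
  intro i j hij
  rw [grid_eq, grid_eq]
  gcongr

lemma grid_mem {N i : ℕ} (hN : 0 < N) (hi : i ≤ N) : grid N i ∈ Set.Icc (7 / 16 : ℝ) (9 / 16) := by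
  have h0 : (0 : ℝ) < N := by exact_mod_cast hN
  have h1 : (i : ℝ) / N ≤ 1 := (div_le_one h0).2 (by exact_mod_cast hi)
  have h2 : (0 : ℝ) ≤ (i : ℝ) / N := by positivity
  rw [grid_eq]
  constructor <;> linarith

/-- The expectation of `f` under `hardLaw N g ε k`, as a finite sum. -/
def hardSum (N : ℕ) (g ε : ℝ) (k : ℕ) (f : ℝ × ℝ → ℝ) : ℝ :=
  (∑ i ∈ Finset.range (N + 1),
    ((gamma1 N g * (1 + 2 * i / (3 * N)) + perturb ε k i) * f (grid N i, 1)
      + (gamma1 N g * (1 - 2 * i / (3 * N)) - perturb ε k i) * f (grid N i, 1 - 3 * ell)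
      + (gamma1 N g * (1 + 2 * (N - i) / (3 * N)) + perturb ε k i) * f (0, grid N i)
      + (gamma1 N g * (1 - 2 * (N - i) / (3 * N)) - perturb ε k i) * f (3 * ell, grid N i)))
  + gamma5 * f ((1 - ell) / 2, (1 + ell) / 2)
  + (gamma6 N g * f (0, 0) + gamma6 N g * f (0, 1)
      + gamma6 N g * f (1, 0) + gamma6 N g * f (1, 1))

instance (w : ℝ) (x : ℝ × ℝ) : IsFiniteMeasure (atom w x) :=
  inferInstanceAs (IsFiniteMeasure (w.toNNReal • Measure.dirac x))

lemma integrable_atom (w : ℝ) (x : ℝ × ℝ) (f : ℝ × ℝ → ℝ) : Integrable f (atom w x) :=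
  (integrable_dirac enorm_lt_top).smul_measure ENNReal.ofReal_ne_top

lemma integral_atom {w : ℝ} (hw : 0 ≤ w) (x : ℝ × ℝ) (f : ℝ × ℝ → ℝ) :
    ∫ v, f v ∂(atom w x) = w * f x := by
  rw [atom, integral_smul_measure, integral_dirac, ENNReal.toReal_ofReal hw, smul_eq_mul]

lemma atom_compl_square (w : ℝ) {x : ℝ × ℝ} (hx : x ∈ Set.Icc (0 : ℝ) 1 ×ˢ Set.Icc (0 : ℝ) 1) :
    atom w x (Set.Icc 0 1 ×ˢ Set.Icc 0 1)ᶜ = 0 := by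
  rw [atom, Measure.smul_apply, Measure.dirac_apply' _ (by measurability)]
  simp only [Set.indicator_of_notMem (Set.notMem_compl_iff.2 hx), smul_zero]

lemma gamma1_mul (N : ℕ) (g : ℝ) : 4 * (N + 1) * gamma1 N g = g := by
  unfold gamma1
  field_simp

lemma gamma6_eq (N : ℕ) (g : ℝ) : gamma6 N g = (1 / 2 - g) / 4 := by
  rw [gamma6, gamma1_mul, gamma5]
  ring

lemma gamma1_nonneg {N : ℕ} {g : ℝ} (hg : 0 ≤ g) : 0 ≤ gamma1 N g := by
  unfold gamma1
  positivity

lemma abs_perturb_le {ε : ℝ} (hε : 0 ≤ ε) (k i : ℕ) : |perturb ε k i| ≤ ε := by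
  unfold perturb
  split_ifs <;> simp [hε, abs_of_nonneg]

/-- The four weights of each index `i` are nonnegative as long as `ε ≤ γ₁ / 3`. -/
lemma weights_nonneg {N : ℕ} {g ε : ℝ} (hN : 0 < N) (hg : 0 ≤ g) (hε : 0 ≤ ε)
    (hε' : ε ≤ gamma1 N g / 3) (k : ℕ) {i : ℕ} (hi : i ≤ N) :
    0 ≤ gamma1 N g * (1 + 2 * i / (3 * N)) + perturb ε k i ∧
    0 ≤ gamma1 N g * (1 - 2 * i / (3 * N)) - perturb ε k i ∧
    0 ≤ gamma1 N g * (1 + 2 * (N - i) / (3 * N)) + perturb ε k i ∧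
    0 ≤ gamma1 N g * (1 - 2 * (N - i) / (3 * N)) - perturb ε k i := by
  have h0 : (0 : ℝ) < N := by exact_mod_cast hN
  have h1 : (i : ℝ) / N ≤ 1 := (div_le_one h0).2 (by exact_mod_cast hi)
  have h2 : (0 : ℝ) ≤ (i : ℝ) / N := by positivity
  have e1 : 2 * (i : ℝ) / (3 * N) = 2 / 3 * (i / N) := by field_simp
  have e2 : 2 * ((N : ℝ) - i) / (3 * N) = 2 / 3 * (1 - i / N) := by field_simp
  rw [e1, e2]
  obtain ⟨p1, p2⟩ := abs_le.1 (abs_perturb_le hε k i)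
  have hγ : 0 ≤ gamma1 N g := gamma1_nonneg hg
  have h3 := mul_nonneg hγ h2
  have h4 := mul_nonneg hγ (sub_nonneg.2 h1)
  refine ⟨?_, ?_, ?_, ?_⟩ <;> nlinarith

lemma integral_hardLaw {N : ℕ} {g ε : ℝ} (hN : 0 < N) (hg : 0 ≤ g) (hg' : g ≤ 1 / 2) (hε : 0 ≤ ε)
    (hε' : ε ≤ gamma1 N g / 3) (k : ℕ) (f : ℝ × ℝ → ℝ) :
    ∫ v, f v ∂(hardLaw N g ε k) = hardSum N g ε k f := by
  have h6 : 0 ≤ gamma6 N g := by rw [gamma6_eq]; linarith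
  have h5 : 0 ≤ gamma5 := by norm_num [gamma5]
  have I : ∀ (w : ℝ) (x : ℝ × ℝ), Integrable f (atom w x) := fun w x => integrable_atom w x f
  have I4 : ∀ i ∈ Finset.range (N + 1), Integrable f
      (atom (gamma1 N g * (1 + 2 * i / (3 * N)) + perturb ε k i) (grid N i, 1)
      + atom (gamma1 N g * (1 - 2 * i / (3 * N)) - perturb ε k i) (grid N i, 1 - 3 * ell)
      + atom (gamma1 N g * (1 + 2 * (N - i) / (3 * N)) + perturb ε k i) (0, grid N i)
      + atom (gamma1 N g * (1 - 2 * (N - i) / (3 * N)) - perturb ε k i) (3 * ell, grid N i)) :=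
    fun i _ => (((I _ _).add_measure (I _ _)).add_measure (I _ _)).add_measure (I _ _)
  have Ic : Integrable f (atom (gamma6 N g) (0, 0) + atom (gamma6 N g) (0, 1)
      + atom (gamma6 N g) (1, 0) + atom (gamma6 N g) (1, 1)) :=
    (((I _ _).add_measure (I _ _)).add_measure (I _ _)).add_measure (I _ _)
  have Is := integrable_finsetSum_measure.2 I4
  unfold hardLaw hardSum
  rw [integral_add_measure (Is.add_measure (I _ _)) Ic, integral_add_measure Is (I _ _),
    integral_finsetSum_measure I4,
    integral_add_measure (((I _ _).add_measure (I _ _)).add_measure (I _ _)) (I _ _),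
    integral_add_measure ((I _ _).add_measure (I _ _)) (I _ _),
    integral_add_measure (I _ _) (I _ _),
    integral_atom h5, integral_atom h6, integral_atom h6, integral_atom h6, integral_atom h6]
  congr 2
  refine Finset.sum_congr rfl fun i hi => ?_
  obtain ⟨w1, w2, w3, w4⟩ :=
    weights_nonneg hN hg hε hε' k (Nat.lt_succ_iff.1 (Finset.mem_range.1 hi))
  rw [integral_add_measure (((I _ _).add_measure (I _ _)).add_measure (I _ _)) (I _ _),
    integral_add_measure ((I _ _).add_measure (I _ _)) (I _ _),
    integral_add_measure (I _ _) (I _ _),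
    integral_atom w1, integral_atom w2, integral_atom w3, integral_atom w4]

lemma hardSum_one (N : ℕ) (g ε : ℝ) (k : ℕ) : hardSum N g ε k (fun _ => 1) = 1 := by
  have h : ∀ i ∈ Finset.range (N + 1),
    ((gamma1 N g * (1 + 2 * i / (3 * N)) + perturb ε k i) * (1 : ℝ)
      + (gamma1 N g * (1 - 2 * i / (3 * N)) - perturb ε k i) * 1
      + (gamma1 N g * (1 + 2 * (N - i) / (3 * N)) + perturb ε k i) * 1
      + (gamma1 N g * (1 - 2 * (N - i) / (3 * N)) - perturb ε k i) * 1) = 4 * gamma1 N g :=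
    fun i _ => by ring
  rw [hardSum, Finset.sum_congr rfl h, gamma6_eq, gamma5]
  have := gamma1_mul N g
  simp only [Finset.sum_const, Finset.card_range, nsmul_eq_mul, Nat.cast_add, Nat.cast_one]
  linarith

lemma hardLaw_compl {N : ℕ} (hN : 0 < N) (g ε : ℝ) (k : ℕ) :
    hardLaw N g ε k (Set.Icc 0 1 ×ˢ Set.Icc 0 1)ᶜ = 0 := by
  have hgr : ∀ i ∈ Finset.range (N + 1), 0 ≤ grid N i ∧ grid N i ≤ 1 := fun i hi => by
    obtain ⟨h1, h2⟩ := grid_mem hN (Nat.lt_succ_iff.1 (Finset.mem_range.1 hi))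
    constructor <;> linarith
  unfold hardLaw
  simp only [Measure.add_apply, Measure.finsetSum_apply]
  rw [Finset.sum_eq_zero]
  · rw [atom_compl_square, atom_compl_square, atom_compl_square, atom_compl_square,
      atom_compl_square]
    · simp
    all_goals norm_num [ell]
  · intro i hi
    have := hgr i hi
    rw [atom_compl_square, atom_compl_square, atom_compl_square, atom_compl_square]
    · simp
    all_goals norm_num [ell, this]

/-- The distribution `μ_k` with `ε = γ₁ / 3`, as a stochastic instance. -/
def hardInstance {N : ℕ} {g : ℝ} (hN : 0 < N) (hg : 0 ≤ g) (hg' : g ≤ 1 / 2) (k : ℕ) :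
    StochasticInstance where
  law := hardLaw N g (gamma1 N g / 3) k
  isProbabilityMeasure := by
    have hfin : IsFiniteMeasure (hardLaw N g (gamma1 N g / 3) k) := by
      unfold hardLaw; infer_instance
    have hγ : 0 ≤ gamma1 N g / 3 := div_nonneg (gamma1_nonneg hg) (by norm_num)
    have h := integral_hardLaw hN hg hg' hγ le_rfl k (fun _ => 1)
    rw [hardSum_one] at h
    simp only [integral_const, smul_eq_mul, mul_one] at h
    refine ⟨?_⟩
    rwa [measureReal_def, ENNReal.toReal_eq_one_iff] at h
  law_compl := hardLaw_compl hN g _ k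

lemma sum_perturb {N k : ℕ} (hk : k < N) (ε : ℝ) (F : ℕ → ℝ) :
    ∑ i ∈ Finset.range (N + 1), perturb ε k i * F i
      = if k = 0 then 0 else ε * (F k - F (k + 1)) := by
  split_ifs with h0
  · simp [perturb, h0]
  · have h : ∀ i ∈ Finset.range (N + 1), perturb ε k i * F i
        = (if i = k then ε * F i else 0) + (if i = k + 1 then -ε * F i else 0) := by
      intro i _
      unfold perturb
      by_cases h1 : i = k
      · simp [h1, h0]
      · by_cases h2 : i = k + 1 <;> simp [h1, h2, h0]
    rw [Finset.sum_congr rfl h, Finset.sum_add_distrib, Finset.sum_ite_eq', Finset.sum_ite_eq',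
      if_pos (by simp; omega), if_pos (by simp; omega)]
    ring

lemma hardSum_sub {N k : ℕ} (hk : k < N) (h0 : k ≠ 0) (g ε : ℝ) (f : ℝ × ℝ → ℝ) :
    hardSum N g ε k f - hardSum N g ε 0 f
      = ε * ((f (grid N k, 1) - f (grid N k, 1 - 3 * ell)
            + f (0, grid N k) - f (3 * ell, grid N k))
          - (f (grid N (k + 1), 1) - f (grid N (k + 1), 1 - 3 * ell)
            + f (0, grid N (k + 1)) - f (3 * ell, grid N (k + 1)))) := by
  have h := sum_perturb hk ε fun i => f (grid N i, 1) - f (grid N i, 1 - 3 * ell)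
            + f (0, grid N i) - f (3 * ell, grid N i)
  rw [if_neg h0] at h
  rw [← h]
  unfold hardSum
  rw [add_sub_add_right_eq_sub, add_sub_add_right_eq_sub, ← Finset.sum_sub_distrib]
  refine Finset.sum_congr rfl fun i _ => ?_
  have : perturb ε 0 i = 0 := by simp [perturb]
  rw [this]
  ring

/-- A lower bound by the four corner atoms alone. -/
lemma hardSum_ge {N : ℕ} {g ε : ℝ} (hN : 0 < N) (hg : 0 ≤ g) (hε : 0 ≤ ε)
    (hε' : ε ≤ gamma1 N g / 3) (k : ℕ) {f : ℝ × ℝ → ℝ} (hf : ∀ v, 0 ≤ f v) :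
    gamma6 N g * (f (0, 0) + f (0, 1) + f (1, 0) + f (1, 1)) ≤ hardSum N g ε k f := by
  have h1 : 0 ≤ ∑ i ∈ Finset.range (N + 1),
    ((gamma1 N g * (1 + 2 * i / (3 * N)) + perturb ε k i) * f (grid N i, 1)
      + (gamma1 N g * (1 - 2 * i / (3 * N)) - perturb ε k i) * f (grid N i, 1 - 3 * ell)
      + (gamma1 N g * (1 + 2 * (N - i) / (3 * N)) + perturb ε k i) * f (0, grid N i)
      + (gamma1 N g * (1 - 2 * (N - i) / (3 * N)) - perturb ε k i) * f (3 * ell, grid N i)) := by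
    refine Finset.sum_nonneg fun i hi => ?_
    obtain ⟨w1, w2, w3, w4⟩ :=
      weights_nonneg hN hg hε hε' k (Nat.lt_succ_iff.1 (Finset.mem_range.1 hi))
    exact add_nonneg (add_nonneg (add_nonneg (mul_nonneg w1 (hf _)) (mul_nonneg w2 (hf _)))
      (mul_nonneg w3 (hf _))) (mul_nonneg w4 (hf _))
  have h2 : 0 ≤ gamma5 * f ((1 - ell) / 2, (1 + ell) / 2) :=
    mul_nonneg (by norm_num [gamma5]) (hf _)
  unfold hardSum
  linarith

/-! ### Informative prices -/

/-- The prices whose feedback has different laws under `μ_0` and `μ_k`. -/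
def infoSet (N k : ℕ) : Set Prices :=
  {x | (5 / 8 < (x.2 : ℝ) ∧ grid N k ≤ x.1 ∧ (x.1 : ℝ) < grid N (k + 1)) ∨
    ((x.1 : ℝ) < 3 / 8 ∧ grid N k < x.2 ∧ (x.2 : ℝ) ≤ grid N (k + 1))}

/-- The prices at which the central atom `((1 - ℓ) / 2, (1 + ℓ) / 2)` does not trade. -/
def exploreSet : Set Prices := {x | ¬ (7 / 16 ≤ (x.1 : ℝ) ∧ (x.2 : ℝ) ≤ 9 / 16)}

/-- The prices that profit from the perturbation of `μ_k`; none for `k = 0`. -/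
def cellSet (N k : ℕ) : Set Prices :=
  {x | k ≠ 0 ∧ grid N k ≤ x.1 ∧ (x.1 : ℝ) < grid N (k + 1)}

lemma measurable_fst_price : Measurable fun x : Prices => (x.1 : ℝ) := by fun_prop

lemma measurable_snd_price : Measurable fun x : Prices => (x.2 : ℝ) := by fun_prop

lemma measurableSet_infoSet (N k : ℕ) : MeasurableSet (infoSet N k) :=
  ((measurableSet_lt measurable_const measurable_snd_price).inter
    ((measurableSet_le measurable_const measurable_fst_price).inter
      (measurableSet_lt measurable_fst_price measurable_const))).union
  ((measurableSet_lt measurable_fst_price measurable_const).inter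
    ((measurableSet_lt measurable_const measurable_snd_price).inter
      (measurableSet_le measurable_snd_price measurable_const)))

lemma measurableSet_exploreSet : MeasurableSet exploreSet :=
  ((measurableSet_le measurable_const measurable_fst_price).inter
    (measurableSet_le measurable_snd_price measurable_const)).compl

lemma measurableSet_cellSet (N k : ℕ) : MeasurableSet (cellSet N k) :=
  (MeasurableSet.const _).inter ((measurableSet_le measurable_const measurable_fst_price).inter
      (measurableSet_lt measurable_fst_price measurable_const))

lemma fbProb_hardInstance {N : ℕ} {g : ℝ} (hN : 0 < N) (hg : 0 ≤ g) (hg' : g ≤ 1 / 2) (k : ℕ)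
    (x : Prices) (o : Bool × Bool) :
    fbProb (hardInstance hN hg hg' k) x o
      = hardSum N g (gamma1 N g / 3) k fun v => if feedback x v = o then 1 else 0 :=
  integral_hardLaw hN hg hg' (div_nonneg (gamma1_nonneg hg) (by norm_num)) le_rfl k _

lemma fbProb_hardInstance_ge {N : ℕ} {g : ℝ} (hN : 0 < N) (hg : 0 ≤ g) (hg' : g ≤ 1 / 4)
    (k : ℕ) {x : Prices} (h1 : (x.1 : ℝ) < 1) (h2 : 0 < (x.2 : ℝ)) (o : Bool × Bool) :
    1 / 16 ≤ fbProb (hardInstance hN hg (hg'.trans (by norm_num)) k) x o := by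
  rw [fbProb_hardInstance]
  have h := hardSum_ge hN hg (div_nonneg (gamma1_nonneg hg) (by norm_num)) le_rfl k
    (f := fun v => if feedback x v = o then (1 : ℝ) else 0) (fun v => by split_ifs <;> simp)
  refine le_trans ?_ h
  have hc : (1 : ℝ) ≤ (if feedback x (0, 0) = o then 1 else 0)
      + (if feedback x (0, 1) = o then 1 else 0) + (if feedback x (1, 0) = o then 1 else 0)
      + (if feedback x (1, 1) = o then 1 else 0) := by
    have f00 : feedback x (0, 0) = (true, false) := by
      simp [feedback, unitInterval.nonneg, h2]
    have f01 : feedback x (0, 1) = (true, true) := by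
      simp [feedback, unitInterval.nonneg, unitInterval.le_one]
    have f10 : feedback x (1, 0) = (false, false) := by
      simp [feedback, h1, h2]
    have f11 : feedback x (1, 1) = (false, true) := by
      simp [feedback, h1, unitInterval.le_one]
    rw [f00, f01, f10, f11]
    obtain ⟨a, b⟩ := o
    cases a <;> cases b <;> simp
  have h6 : 1 / 16 ≤ gamma6 N g := by rw [gamma6_eq]; linarith
  nlinarith

/-- The marginal laws of all instances coincide, and so do the joint laws of the two bits unless
one price separates the two halves of a row of the gadget while the other separates the two
grid points affected by the perturbation. -/
lemma fbProb_sub {N k : ℕ} {g : ℝ} (hN : 0 < N) (hg : 0 ≤ g) (hg' : g ≤ 1 / 2) (hk : k < N)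
    (h0 : k ≠ 0) (x : Prices) (o : Bool × Bool) :
    |fbProb (hardInstance hN hg hg' k) x o - fbProb (hardInstance hN hg hg' 0) x o|
      ≤ gamma1 N g / 3 * (infoSet N k).indicator 1 x := by
  have hγ : 0 ≤ gamma1 N g / 3 := div_nonneg (gamma1_nonneg hg) (by norm_num)
  rw [fbProb_hardInstance, fbProb_hardInstance, hardSum_sub hk h0, abs_mul, abs_of_nonneg hγ]
  refine mul_le_mul_of_nonneg_left ?_ hγ
  obtain ⟨⟨p, hp0, hp1⟩, ⟨q, hq0, hq1⟩⟩ := x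
  obtain ⟨a, b⟩ := o
  have e1 : (1 : ℝ) - 3 / 8 = 5 / 8 := by norm_num
  have e2 : (3 : ℝ) * ell = 3 / 8 := by norm_num [ell]
  obtain ⟨y1, y2⟩ := grid_mem hN hk.le
  obtain ⟨z1, z2⟩ := grid_mem hN hk
  have hyz := grid_mono N (Nat.le_succ k)
  simp only [Nat.succ_eq_add_one] at hyz
  simp only [Set.indicator_apply, infoSet, Set.mem_ofPred_eq, feedback, e1, e2, Prod.mk.injEq]
  generalize grid N k = y at *
  generalize grid N (k + 1) = z at *
  -- If `q ≤ 5 / 8`, the atoms `(x_i, 1)` and `(x_i, 5 / 8)` give the same feedback, and if `3 / 8 ≤ p`,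
  -- the atoms `(0, x_i)` and `(3 / 8, x_i)` do, so that their opposite perturbations cancel.
  by_cases c1 : 5 / 8 < q
  · have d1 : ¬ q ≤ 5 / 8 := not_le.2 c1
    have d2 : ¬ q ≤ y := by linarith
    have d3 : ¬ q ≤ z := by linarith
    have d4 : ¬ (p < 3 / 8 ∧ y < q ∧ q ≤ z) := fun h => d3 h.2.2
    by_cases c2 : y ≤ p
    · have c4 : 3 / 8 ≤ p := by linarith
      by_cases c3 : z ≤ p
      · have d5 : ¬ p < z := not_lt.2 c3
        cases a <;> cases b <;> simp [c1, c2, c3, c4, d1, d2, d3, d5, hp0, hq1]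
      · have d5 : p < z := not_le.1 c3
        cases a <;> cases b <;> simp [c1, c2, c3, c4, d1, d2, d3, d5, hp0, hq1]
    · have c3 : ¬ z ≤ p := by linarith
      by_cases c4 : 3 / 8 ≤ p <;>
      cases a <;> cases b <;> simp [c1, c2, c3, c4, d1, d2, d3, hp0, hq1]
  · have d1 : q ≤ 5 / 8 := not_lt.1 c1
    by_cases c4 : 3 / 8 ≤ p
    · have d2 : ¬ p < 3 / 8 := not_lt.2 c4
      by_cases c2 : y ≤ p <;> by_cases c3 : z ≤ p <;> by_cases c5 : q ≤ y <;>
        by_cases c6 : q ≤ z <;>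
      cases a <;> cases b <;> simp [c1, c2, c3, c4, c5, c6, d1, d2, hp0, hq1]
    · have d2 : p < 3 / 8 := not_le.1 c4
      have c2 : ¬ y ≤ p := by linarith
      have c3 : ¬ z ≤ p := by linarith
      by_cases c5 : q ≤ y
      · have c6 : q ≤ z := by linarith
        have c7 : ¬ y < q := not_lt.2 c5
        cases a <;> cases b <;> simp [c1, c2, c3, c4, c5, c6, c7, d1, d2, hp0, hq1]
      · have c7 : y < q := not_le.1 c5
        by_cases c6 : q ≤ z <;>
        cases a <;> cases b <;> simp [c1, c2, c3, c4, c5, c6, c7, d1, d2, hp0, hq1]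

lemma distinguishable_hardInstance {N k : ℕ} {g : ℝ} (hN : 0 < N) (hg : 0 ≤ g) (hg' : g ≤ 1 / 4)
    (hk : k < N) (h0 : k ≠ 0) :
    Distinguishable (hardInstance hN hg (hg'.trans (by norm_num)) 0)
      (hardInstance hN hg (hg'.trans (by norm_num)) k) (infoSet N k)
      (64 * (gamma1 N g / 3) ^ 2) := by
  have hmem : ∀ x ∈ infoSet N k, (x.1 : ℝ) < 1 ∧ 0 < (x.2 : ℝ) := by
    obtain ⟨y1, y2⟩ := grid_mem hN hk.le
    obtain ⟨z1, z2⟩ := grid_mem hN hk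
    rintro x (⟨h1, h2, h3⟩ | ⟨h1, h2, h3⟩) <;> simp only [Nat.succ_eq_add_one] at * <;>
      constructor <;> linarith
  have hlow : ∀ j, ∀ x ∈ infoSet N k, ∀ o,
      1 / 16 ≤ fbProb (hardInstance hN hg (hg'.trans (by norm_num)) j) x o :=
    fun j x hx o => fbProb_hardInstance_ge hN hg hg' j (hmem x hx).1 (hmem x hx).2 o
  have hsub := fbProb_sub hN hg (hg'.trans (by norm_num)) hk h0
  refine ⟨fun x hx o => ?_, fun x hx o => ?_, fun x hx o => ?_, fun x hx => ?_⟩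
  · have h := hsub x o
    rw [Set.indicator_of_notMem hx, mul_zero] at h
    exact (sub_eq_zero.1 (abs_nonpos_iff.1 h)).symm
  · linarith [hlow 0 x hx o]
  · linarith [hlow k x hx o]
  · have h : ∀ o, (fbProb (hardInstance hN hg (hg'.trans (by norm_num)) 0) x o
          - fbProb (hardInstance hN hg (hg'.trans (by norm_num)) k) x o) ^ 2
          / fbProb (hardInstance hN hg (hg'.trans (by norm_num)) k) x o
        ≤ 16 * (gamma1 N g / 3) ^ 2 := by
      intro o
      have h1 := hlow k x hx o
      have h2 := hsub x o
      rw [Set.indicator_of_mem hx, Pi.one_apply, mul_one, abs_sub_comm] at h2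
      have h3 := sq_le_sq' (by linarith [abs_le.1 h2]) (abs_le.1 h2).2
      rw [div_le_iff₀ (by linarith)]
      nlinarith [sq_nonneg (gamma1 N g / 3)]
    refine (Finset.sum_le_sum fun o _ => h o).trans (le_of_eq ?_)
    simp
    ring

lemma sum_cellSet_le (N : ℕ) (x : Prices) :
    ∑ k ∈ Finset.Ico 1 N, (cellSet N k).indicator (1 : Prices → ℝ) x ≤ 1 := by
  classical
  simp only [Set.indicator_apply, Pi.one_apply, Finset.sum_boole]
  rw [Nat.cast_le_one, Finset.card_le_one]
  intro i hi j hj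
  rw [Finset.mem_filter] at hi hj
  simp only [cellSet, Set.mem_ofPred_eq] at hi hj
  rcases lt_trichotomy i j with h | h | h
  · linarith [grid_mono N (Nat.succ_le_of_lt h), hi.2.2.2, hj.2.2.1]
  · exact h
  · linarith [grid_mono N (Nat.succ_le_of_lt h), hj.2.2.2, hi.2.2.1]

lemma sum_infoSet_le (N : ℕ) (x : Prices) :
    ∑ k ∈ Finset.Ico 1 N, (infoSet N k).indicator (1 : Prices → ℝ) x
      ≤ exploreSet.indicator 1 x := by
  classical
  by_cases hx : x ∈ exploreSet
  · rw [Set.indicator_of_mem hx]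
    simp only [Set.indicator_apply, Pi.one_apply, Finset.sum_boole]
    rw [Nat.cast_le_one, Finset.card_le_one]
    have hgr : ∀ i ∈ Finset.Ico 1 N, 7 / 16 ≤ grid N i ∧ grid N (i + 1) ≤ 9 / 16 := by
      intro i hi
      rw [Finset.mem_Ico] at hi
      exact ⟨(grid_mem (by omega) (by omega)).1, (grid_mem (by omega) (by omega)).2⟩
    intro i hi j hj
    rw [Finset.mem_filter] at hi hj
    simp only [infoSet, Set.mem_ofPred_eq] at hi hj
    have hi1 := hgr i hi.1
    have hj1 := hgr j hj.1
    rcases lt_trichotomy i j with h | h | h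
    · have hm := grid_mono N (Nat.succ_le_of_lt h)
      simp only [Nat.succ_eq_add_one] at hm
      rcases hi.2 with a | a <;> rcases hj.2 with b | b <;> linarith
    · exact h
    · have hm := grid_mono N (Nat.succ_le_of_lt h)
      simp only [Nat.succ_eq_add_one] at hm
      rcases hi.2 with a | a <;> rcases hj.2 with b | b <;> linarith
  · rw [Set.indicator_of_notMem hx]
    refine le_of_eq (Finset.sum_eq_zero fun i hi => Set.indicator_of_notMem (fun hxi => hx ?_) _)
    rw [Finset.mem_Ico] at hi
    have h1 := (grid_mem (N := N) (i := i) (by omega) (by omega)).1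
    rintro ⟨h2, h3⟩
    rcases hxi with a | a <;> linarith

/-! ### Gain from trade against revenue -/

lemma abs_gft_le_one {p q : ℝ} {v : ℝ × ℝ} (hv : v ∈ Set.Icc (0 : ℝ) 1 ×ˢ Set.Icc (0 : ℝ) 1) :
    |gft p q v| ≤ 1 := by
  obtain ⟨⟨h1, h2⟩, h3, h4⟩ := hv
  unfold gft
  split_ifs
  · rw [abs_le]
    constructor <;> linarith
  · simp

lemma abs_rev_le_one (x : Prices) (v : ℝ × ℝ) : |rev x.1 x.2 v| ≤ 1 := by
  have h1 := x.1.2.1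
  have h2 := x.1.2.2
  have h3 := x.2.2.1
  have h4 := x.2.2.2
  unfold rev
  split_ifs
  · rw [abs_le]
    constructor <;> linarith
  · simp

lemma measurableSet_trade :
    MeasurableSet {z : Prices × (ℝ × ℝ) | z.2.1 ≤ (z.1.1 : ℝ) ∧ (z.1.2 : ℝ) ≤ z.2.2} :=
  (measurableSet_le (measurable_fst.comp measurable_snd)
      (measurable_fst_price.comp measurable_fst)).inter
    (measurableSet_le (measurable_snd_price.comp measurable_fst)
      (measurable_snd.comp measurable_snd))

lemma bddMeas_expGFT (P : StochasticInstance) : BddMeas fun x => expGFT P x.1 x.2 := by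
  refine ⟨?_, 1, fun x => ?_⟩
  · have h : Measurable fun z : Prices × (ℝ × ℝ) => gft z.1.1 z.1.2 z.2 :=
      Measurable.ite measurableSet_trade (by fun_prop) measurable_const
    exact (h.stronglyMeasurable.integral_prod_right (ν := P.law)).measurable
  · have h : ∀ᵐ v ∂P.law, ‖gft x.1 x.2 v‖ ≤ 1 := by
      filter_upwards [mem_ae_iff.2 P.law_compl] with v hv
      exact abs_gft_le_one hv
    simpa [expGFT] using norm_integral_le_of_norm_le_const h

lemma abs_expRev_le_one (P : StochasticInstance) (x : Prices) : |expRev P x.1 x.2| ≤ 1 := by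
  have h : ∀ᵐ v ∂P.law, ‖rev x.1 x.2 v‖ ≤ 1 :=
    Filter.Eventually.of_forall fun v => abs_rev_le_one x v
  simpa [expRev] using norm_integral_le_of_norm_le_const h

lemma bddMeas_expRev (P : StochasticInstance) : BddMeas fun x => expRev P x.1 x.2 := by
  refine ⟨?_, 1, abs_expRev_le_one P⟩
  have h : Measurable fun z : Prices × (ℝ × ℝ) => rev z.1.1 z.1.2 z.2 :=
    Measurable.ite measurableSet_trade (by fun_prop) measurable_const
  exact (h.stronglyMeasurable.integral_prod_right (ν := P.law)).measurable

/-- The number of grid points accepted by the seller's price `p` plus the number accepted by the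
buyer's price `q`. -/
def gridCount (N : ℕ) (p q : ℝ) : ℝ :=
  ∑ i ∈ Finset.range (N + 1),
    ((if grid N i ≤ p then (1 : ℝ) else 0) + if q ≤ grid N i then (1 : ℝ) else 0)

/-- The largest expected gain from trade of a single price under `μ_0`. -/
def bestGFT (N : ℕ) (g : ℝ) : ℝ := 1 / 16 + gamma6 N g + 3 / 4 * gamma1 N g * (N + 2)

/-- The probability of a trade under `μ_0` at a single price on the grid. -/
def tradeProb (N : ℕ) (g : ℝ) : ℝ := 1 / 2 + gamma6 N g + 2 * gamma1 N g * (N + 2)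

/-- The gain from trade bought by one unit of budget violation. -/
def exchangeRate (N : ℕ) (g : ℝ) : ℝ := 6 * N * gamma1 N g / tradeProb N g

/-- At prices at which the central atom trades, each grid point accepted by one of the two prices
contributes `3 γ₁ / 4`, independently of its position. -/
lemma hardSum_gft {N : ℕ} (hN : 0 < N) (g ε : ℝ) (k : ℕ) {p q : ℝ} (hp : 7 / 16 ≤ p)
    (hq : q ≤ 9 / 16) :
    hardSum N g ε k (gft p q)
      = 1 / 16 + gamma6 N g * (1 - if 1 ≤ p ∧ q ≤ 0 then 1 else 0)
        + 3 / 4 * gamma1 N g * gridCount N p q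
        + 3 / 8 * ∑ i ∈ Finset.range (N + 1), perturb ε k i *
          ((if grid N i ≤ p then (1 : ℝ) else 0) + if q ≤ grid N i then (1 : ℝ) else 0) := by
  have h0 : (N : ℝ) ≠ 0 := by exact_mod_cast hN.ne'
  have hterm : ∀ i ∈ Finset.range (N + 1),
      ((gamma1 N g * (1 + 2 * i / (3 * N)) + perturb ε k i) * gft p q (grid N i, 1)
      + (gamma1 N g * (1 - 2 * i / (3 * N)) - perturb ε k i) * gft p q (grid N i, 1 - 3 * ell)
      + (gamma1 N g * (1 + 2 * (N - i) / (3 * N)) + perturb ε k i) * gft p q (0, grid N i)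
      + (gamma1 N g * (1 - 2 * (N - i) / (3 * N)) - perturb ε k i) * gft p q (3 * ell, grid N i))
      = 3 / 4 * gamma1 N g *
          ((if grid N i ≤ p then (1 : ℝ) else 0) + if q ≤ grid N i then (1 : ℝ) else 0)
        + 3 / 8 * (perturb ε k i *
          ((if grid N i ≤ p then (1 : ℝ) else 0) + if q ≤ grid N i then (1 : ℝ) else 0)) := by
    intro i _
    have b1 : q ≤ 1 := by linarith
    have b2 : q ≤ 1 - 3 * ell := by norm_num [ell]; linarith
    have b3 : 0 ≤ p := by linarith
    have b4 : 3 * ell ≤ p := by norm_num [ell]; linarith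
    simp only [gft, b1, b2, b3, b4, and_true, true_and]
    have e : grid N i = 7 / 16 + (i / N : ℝ) / 8 := grid_eq N i
    by_cases c1 : grid N i ≤ p <;> by_cases c2 : q ≤ grid N i <;>
      simp only [c1, c2, if_true, if_false] <;> try simp only [e, ell]
    all_goals field_simp
    all_goals ring
  have c1 : (1 - ell) / 2 ≤ p := by norm_num [ell]; linarith
  have c2 : q ≤ (1 + ell) / 2 := by norm_num [ell]; linarith
  have c3 : (0 : ℝ) ≤ p := by linarith
  have c4 : q ≤ 1 := by linarith
  have hell : (1 + ell) / 2 - (1 - ell) / 2 = 1 / 8 := by norm_num [ell]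
  rw [hardSum, Finset.sum_congr rfl hterm, Finset.sum_add_distrib, ← Finset.mul_sum,
    ← Finset.mul_sum]
  simp only [gft, c1, c2, c3, c4, and_self, true_and, and_true, if_true, gridCount, hell, gamma5]
  by_cases d : 1 ≤ p ∧ q ≤ 0 <;> simp [d] <;> ring

lemma hardSum_rev {N : ℕ} (g ε : ℝ) (k : ℕ) {p q : ℝ} (hp : 7 / 16 ≤ p) (hq : q ≤ 9 / 16) :
    hardSum N g ε k (rev p q)
      = (q - p) * (1 / 2 + gamma6 N g * (1 + (if q ≤ 0 then 1 else 0) + (if 1 ≤ p then 1 else 0)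
          + if 1 ≤ p ∧ q ≤ 0 then 1 else 0) + 2 * gamma1 N g * gridCount N p q) := by
  have hterm : ∀ i ∈ Finset.range (N + 1),
      ((gamma1 N g * (1 + 2 * i / (3 * N)) + perturb ε k i) * rev p q (grid N i, 1)
      + (gamma1 N g * (1 - 2 * i / (3 * N)) - perturb ε k i) * rev p q (grid N i, 1 - 3 * ell)
      + (gamma1 N g * (1 + 2 * (N - i) / (3 * N)) + perturb ε k i) * rev p q (0, grid N i)
      + (gamma1 N g * (1 - 2 * (N - i) / (3 * N)) - perturb ε k i) * rev p q (3 * ell, grid N i))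
      = (q - p) * (2 * gamma1 N g) *
          ((if grid N i ≤ p then (1 : ℝ) else 0) + if q ≤ grid N i then (1 : ℝ) else 0) := by
    intro i _
    have b1 : q ≤ 1 := by linarith
    have b2 : q ≤ 1 - 3 * ell := by norm_num [ell]; linarith
    have b3 : 0 ≤ p := by linarith
    have b4 : 3 * ell ≤ p := by norm_num [ell]; linarith
    simp only [rev, b1, b2, b3, b4, and_true, true_and]
    by_cases c1 : grid N i ≤ p <;> by_cases c2 : q ≤ grid N i <;>
      simp only [c1, c2, if_true, if_false] <;> ring
  have c1 : (1 - ell) / 2 ≤ p := by norm_num [ell]; linarith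
  have c2 : q ≤ (1 + ell) / 2 := by norm_num [ell]; linarith
  have c3 : (0 : ℝ) ≤ p := by linarith
  have c4 : q ≤ 1 := by linarith
  rw [hardSum, Finset.sum_congr rfl hterm, ← Finset.mul_sum]
  simp only [rev, c1, c2, c3, c4, and_self, true_and, and_true, if_true, gridCount, gamma5]
  by_cases d : 1 ≤ p <;> by_cases e : q ≤ 0 <;> simp [d, e] <;> ring

/-- At most `1 + y` indices satisfy `c` if some injection maps them into `{0, …, ⌊y⌋}`. -/
lemma sum_ite_le {N : ℕ} {y : ℝ} (hy : 0 ≤ y) {f : ℕ → ℕ} (hf : Set.InjOn f (Finset.range (N + 1)))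
    {c : ℕ → Prop} [DecidablePred c] (h : ∀ i ∈ Finset.range (N + 1), c i → (f i : ℝ) ≤ y) :
    ∑ i ∈ Finset.range (N + 1), (if c i then (1 : ℝ) else 0) ≤ 1 + y := by
  rw [Finset.sum_boole]
  have h1 : ((Finset.range (N + 1)).filter c).card ≤ (Finset.range (⌊y⌋₊ + 1)).card := by
    refine Finset.card_le_card_of_injOn f (fun i hi => ?_) (hf.mono ?_)
    · have hi' := Finset.mem_filter.1 hi
      exact Finset.mem_coe.2 (Finset.mem_range.2 (Nat.lt_succ_iff.2
        (Nat.le_floor (h i hi'.1 hi'.2))))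
    · exact_mod_cast Finset.filter_subset _ _
  rw [Finset.card_range] at h1
  have h2 : (((Finset.range (N + 1)).filter c).card : ℝ) ≤ (⌊y⌋₊ + 1 : ℕ) := by exact_mod_cast h1
  push_cast at h2
  linarith [Nat.floor_le hy]

/-- To accept `m` grid points more than a single price does, the prices must cross by `m` grid
steps. -/
lemma gridCount_le {N : ℕ} (hN : 0 < N) {p q : ℝ} (hp : 7 / 16 ≤ p) (hq : q ≤ 9 / 16) :
    gridCount N p q ≤ N + 2 + 8 * N * (p - q) := by
  have h0 : (0 : ℝ) < N := by exact_mod_cast hN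
  unfold gridCount
  rw [Finset.sum_add_distrib]
  have h1 : ∑ i ∈ Finset.range (N + 1), (if grid N i ≤ p then (1 : ℝ) else 0)
      ≤ 1 + 8 * N * (p - 7 / 16) := by
    refine sum_ite_le (mul_nonneg (by positivity) (by linarith)) (f := id) (fun _ _ _ _ h => h) ?_
    intro i _ hc
    rw [grid_eq] at hc
    have : (i : ℝ) = 8 * N * ((i / N : ℝ) / 8) := by field_simp
    rw [id, this]
    exact mul_le_mul_of_nonneg_left (by linarith) (by positivity)
  have h2 : ∑ i ∈ Finset.range (N + 1), (if q ≤ grid N i then (1 : ℝ) else 0)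
      ≤ 1 + 8 * N * (9 / 16 - q) := by
    refine sum_ite_le (mul_nonneg (by positivity) (by linarith)) (f := fun i => N - i) ?_ ?_
    · intro i hi j hj h
      simp only [Finset.coe_range, Set.mem_Iio] at hi hj h
      omega
    · intro i hi hc
      rw [grid_eq] at hc
      rw [Nat.cast_sub (Nat.lt_succ_iff.1 (Finset.mem_range.1 hi))]
      have : (N : ℝ) - i = 8 * N * (1 / 8 - (i / N : ℝ) / 8) := by field_simp
      rw [this]
      exact mul_le_mul_of_nonneg_left (by linarith) (by positivity)
  linarith

lemma tradeProb_ge {N : ℕ} {g : ℝ} (hg : 0 ≤ g) (hg' : g ≤ 1 / 2) : 1 / 2 ≤ tradeProb N g := by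
  unfold tradeProb
  have h1 : 0 ≤ gamma6 N g := by rw [gamma6_eq]; linarith
  have h2 : 0 ≤ gamma1 N g := gamma1_nonneg hg
  have : 0 ≤ 2 * gamma1 N g * (N + 2) := by positivity
  linarith

lemma exchangeRate_nonneg {N : ℕ} {g : ℝ} (hg : 0 ≤ g) (hg' : g ≤ 1 / 2) :
    0 ≤ exchangeRate N g :=
  div_nonneg (mul_nonneg (by positivity) (gamma1_nonneg hg))
    (by linarith [tradeProb_ge (N := N) hg hg'])

lemma exchangeRate_le {N : ℕ} {g : ℝ} (hg : 0 ≤ g) (hg' : g ≤ 1 / 2) :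
    exchangeRate N g ≤ 3 * g := by
  have h := tradeProb_ge (N := N) hg hg'
  have h1 := gamma1_mul N g
  have h2 : 0 ≤ gamma1 N g := gamma1_nonneg hg
  unfold exchangeRate
  rw [div_le_iff₀ (by linarith)]
  nlinarith

/-- At prices at which the central atom trades, every grid point gained over a single price is paid
for by budget violation at the exchange rate, and every unit of revenue costs grid points at the
same rate. -/
lemma gridCount_add_exchangeRate_mul_le {N : ℕ} (hN : 0 < N) {g : ℝ} (hg : 0 ≤ g) (hg' : g ≤ 1 / 2)
    (ε : ℝ) (k : ℕ) {p q : ℝ} (hp : 7 / 16 ≤ p) (hq : q ≤ 9 / 16) :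
    3 / 4 * gamma1 N g * (gridCount N p q - (N + 2))
      + exchangeRate N g * hardSum N g ε k (rev p q) ≤ 0 := by
  have hN0 : (0 : ℝ) < N := by exact_mod_cast hN
  have h6 : 0 ≤ gamma6 N g := by rw [gamma6_eq]; linarith
  have h1 : 0 ≤ gamma1 N g := gamma1_nonneg hg
  have hP0 := tradeProb_ge (N := N) hg hg'
  have hlam := exchangeRate_nonneg (N := N) hg hg'
  have hlamP : exchangeRate N g * tradeProb N g = 6 * N * gamma1 N g :=
    div_mul_cancel₀ _ (by linarith)
  have hn := gridCount_le hN hp hq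
  have hn0 : 0 ≤ gridCount N p q :=
    Finset.sum_nonneg fun i _ => add_nonneg (by split_ifs <;> simp) (by split_ifs <;> simp)
  rw [hardSum_rev g ε k hp hq]
  set n := gridCount N p q
  have hkey : (q - p) * (1 / 2 + gamma6 N g * (1 + (if q ≤ 0 then 1 else 0)
      + (if 1 ≤ p then 1 else 0) + if 1 ≤ p ∧ q ≤ 0 then 1 else 0) + 2 * gamma1 N g * n)
      ≤ (N + 2 - n) / (8 * N) * tradeProb N g := by
    have hqp : q - p ≤ (N + 2 - n) / (8 * N) := by
      rw [le_div_iff₀ (by positivity)]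
      linarith
    -- `tradeProb N g` bounds the probability of a trade from above when revenue is earned and from
    -- below when extra grid points are bought, which is why one exchange rate serves both cases.
    rcases le_or_gt p q with hpq | hpq
    · have c1 : ¬ q ≤ 0 := by linarith
      have c2 : ¬ 1 ≤ p := by linarith
      have hn' : n ≤ N + 2 := by nlinarith
      simp only [c1, c2, and_self, if_false, add_zero, mul_one]
      refine mul_le_mul hqp ?_ (by positivity) (by linarith)
      unfold tradeProb
      nlinarith
    · rcases le_or_gt n (N + 2) with hn' | hn'
      · refine (mul_nonpos_of_nonpos_of_nonneg (by linarith) (by positivity)).trans ?_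
        exact mul_nonneg (div_nonneg (by linarith) (by positivity)) (by linarith)
      · have hP : tradeProb N g ≤ 1 / 2 + gamma6 N g * (1 + (if q ≤ 0 then 1 else 0)
            + (if 1 ≤ p then 1 else 0) + if 1 ≤ p ∧ q ≤ 0 then 1 else 0)
            + 2 * gamma1 N g * n := by
          have : (1 : ℝ) ≤ 1 + (if q ≤ 0 then 1 else 0)
            + (if 1 ≤ p then 1 else 0) + if 1 ≤ p ∧ q ≤ 0 then 1 else 0 := by
            split_ifs <;> norm_num
          unfold tradeProb
          nlinarith
        calc _ ≤ (q - p) * tradeProb N g := mul_le_mul_of_nonpos_left hP (by linarith)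
          _ ≤ _ := mul_le_mul_of_nonneg_right hqp (by linarith)
  have h3 := mul_le_mul_of_nonneg_left hkey hlam
  have h4 : exchangeRate N g * ((N + 2 - n) / (8 * N) * tradeProb N g)
      = 3 / 4 * gamma1 N g * (N + 2 - n) := by
    calc _ = exchangeRate N g * tradeProb N g * ((N + 2 - n) / (8 * N)) := by ring
      _ = _ := by rw [hlamP]; field_simp; ring
  linarith

/-- Prices at which the central atom does not trade gain at most `γ₆ + g`. -/
lemma hardSum_gft_le {N : ℕ} (hN : 0 < N) {g ε : ℝ} (hg : 0 ≤ g) (hg' : g ≤ 1 / 2) (hε : 0 ≤ ε)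
    (hε' : ε ≤ gamma1 N g / 3) (k : ℕ) {p q : ℝ} (h : ¬ (7 / 16 ≤ p ∧ q ≤ 9 / 16)) :
    hardSum N g ε k (gft p q) ≤ gamma6 N g + g := by
  have h6 : 0 ≤ gamma6 N g := by rw [gamma6_eq]; linarith
  have hsum : ∑ i ∈ Finset.range (N + 1),
    ((gamma1 N g * (1 + 2 * i / (3 * N)) + perturb ε k i) * gft p q (grid N i, 1)
      + (gamma1 N g * (1 - 2 * i / (3 * N)) - perturb ε k i) * gft p q (grid N i, 1 - 3 * ell)
      + (gamma1 N g * (1 + 2 * (N - i) / (3 * N)) + perturb ε k i) * gft p q (0, grid N i)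
      + (gamma1 N g * (1 - 2 * (N - i) / (3 * N)) - perturb ε k i) * gft p q (3 * ell, grid N i))
      ≤ g := by
    have hle : ∀ i ∈ Finset.range (N + 1),
      ((gamma1 N g * (1 + 2 * i / (3 * N)) + perturb ε k i) * gft p q (grid N i, 1)
      + (gamma1 N g * (1 - 2 * i / (3 * N)) - perturb ε k i) * gft p q (grid N i, 1 - 3 * ell)
      + (gamma1 N g * (1 + 2 * (N - i) / (3 * N)) + perturb ε k i) * gft p q (0, grid N i)
      + (gamma1 N g * (1 - 2 * (N - i) / (3 * N)) - perturb ε k i) * gft p q (3 * ell, grid N i))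
        ≤ 4 * gamma1 N g := by
      intro i hi
      have hi' := Nat.lt_succ_iff.1 (Finset.mem_range.1 hi)
      obtain ⟨w1, w2, w3, w4⟩ := weights_nonneg hN hg hε hε' k hi'
      obtain ⟨y1, y2⟩ := grid_mem hN hi'
      have b : ∀ v : ℝ × ℝ, v ∈ Set.Icc (0 : ℝ) 1 ×ˢ Set.Icc (0 : ℝ) 1 → gft p q v ≤ 1 :=
        fun v hv => (abs_le.1 (abs_gft_le_one hv)).2
      have m1 := mul_le_mul_of_nonneg_left (b (grid N i, 1) (by
        refine ⟨⟨?_, ?_⟩, ?_, ?_⟩ <;> simp only <;> linarith)) w1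
      have m2 := mul_le_mul_of_nonneg_left (b (grid N i, 1 - 3 * ell) (by
        refine ⟨⟨?_, ?_⟩, ?_, ?_⟩ <;> simp only [ell] <;> linarith)) w2
      have m3 := mul_le_mul_of_nonneg_left (b (0, grid N i) (by
        refine ⟨⟨?_, ?_⟩, ?_, ?_⟩ <;> simp only <;> linarith)) w3
      have m4 := mul_le_mul_of_nonneg_left (b (3 * ell, grid N i) (by
        refine ⟨⟨?_, ?_⟩, ?_, ?_⟩ <;> simp only [ell] <;> linarith)) w4
      linarith
    refine (Finset.sum_le_sum hle).trans (le_of_eq ?_)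
    have := gamma1_mul N g
    simp only [Finset.sum_const, Finset.card_range, nsmul_eq_mul, Nat.cast_add, Nat.cast_one]
    linarith
  have hc : gft p q ((1 - ell) / 2, (1 + ell) / 2) = 0 := by
    refine if_neg fun hc => h ?_
    norm_num [ell] at hc
    exact hc
  have h00 : gft p q (0, 0) = 0 := by simp [gft]
  have h11 : gft p q (1, 1) = 0 := by simp [gft]
  have h01 : gft p q (0, 1) ≤ 1 := by unfold gft; split_ifs <;> norm_num
  have h10 : gft p q (1, 0) ≤ 0 := by unfold gft; split_ifs <;> norm_num
  have m1 := mul_le_mul_of_nonneg_left h01 h6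
  have m2 := mul_le_mul_of_nonneg_left h10 h6
  rw [hardSum, hc, h00, h11]
  linarith

lemma expGFT_hardInstance {N : ℕ} {g : ℝ} (hN : 0 < N) (hg : 0 ≤ g) (hg' : g ≤ 1 / 2) (k : ℕ)
    (p q : ℝ) :
    expGFT (hardInstance hN hg hg' k) p q = hardSum N g (gamma1 N g / 3) k (gft p q) :=
  integral_hardLaw hN hg hg' (div_nonneg (gamma1_nonneg hg) (by norm_num)) le_rfl k _

lemma expRev_hardInstance {N : ℕ} {g : ℝ} (hN : 0 < N) (hg : 0 ≤ g) (hg' : g ≤ 1 / 2) (k : ℕ)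
    (p q : ℝ) :
    expRev (hardInstance hN hg hg' k) p q = hardSum N g (gamma1 N g / 3) k (rev p q) :=
  integral_hardLaw hN hg hg' (div_nonneg (gamma1_nonneg hg) (by norm_num)) le_rfl k _

/-- The Lagrangian bound: up to the price of budget violation, the best single price of `μ_0`
is only beaten on the cell of `μ_k`, and exploration costs a constant. -/
lemma expGFT_hardInstance_le {N k : ℕ} {g : ℝ} (hN : 0 < N) (hg : 0 ≤ g) (hg' : g ≤ 1 / 128)
    (hk : k < N) (x : Prices) :
    expGFT (hardInstance hN hg (hg'.trans (by norm_num)) k) x.1 x.2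
      + exchangeRate N g * expRev (hardInstance hN hg (hg'.trans (by norm_num)) k) x.1 x.2
      + 1 / 32 * exploreSet.indicator 1 x
      ≤ bestGFT N g + gamma1 N g / 8 * (cellSet N k).indicator 1 x := by
  have h2 : g ≤ 1 / 2 := hg'.trans (by norm_num)
  have hγ : 0 ≤ gamma1 N g := gamma1_nonneg hg
  have h6 : 0 ≤ gamma6 N g := by rw [gamma6_eq]; linarith
  have hcell : 0 ≤ gamma1 N g / 8 * (cellSet N k).indicator (1 : Prices → ℝ) x :=
    mul_nonneg (by linarith) (Set.indicator_nonneg (fun _ _ => zero_le_one) _)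
  by_cases hx : x ∈ exploreSet
  · have a1 := hardSum_gft_le hN hg h2 (div_nonneg hγ (by norm_num)) le_rfl k hx
    rw [← expGFT_hardInstance hN hg h2] at a1
    have a2 := (abs_le.1 (abs_expRev_le_one (hardInstance hN hg h2 k) x)).2
    have a3 := mul_le_mul_of_nonneg_left a2 (exchangeRate_nonneg (N := N) hg h2)
    have a4 := exchangeRate_le (N := N) hg h2
    have a5 : 0 ≤ 3 / 4 * gamma1 N g * (N + 2) := by positivity
    rw [Set.indicator_of_mem hx, Pi.one_apply, bestGFT]
    linarith
  · obtain ⟨hp, hq⟩ := not_not.1 hx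
    have a1 := gridCount_add_exchangeRate_mul_le hN hg h2 (gamma1 N g / 3) k hp hq
    rw [Set.indicator_of_notMem hx, expGFT_hardInstance, expRev_hardInstance,
      hardSum_gft hN _ _ _ hp hq, sum_perturb hk]
    have a2 : gamma6 N g * (1 - if 1 ≤ (x.1 : ℝ) ∧ (x.2 : ℝ) ≤ 0 then 1 else 0) ≤ gamma6 N g := by
      split_ifs <;> simp [h6]
    have a3 : (3 / 8 : ℝ) * (if k = 0 then 0 else gamma1 N g / 3 *
          (((if grid N k ≤ x.1 then (1 : ℝ) else 0) + if x.2 ≤ grid N k then (1 : ℝ) else 0)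
          - ((if grid N (k + 1) ≤ x.1 then (1 : ℝ) else 0)
            + if x.2 ≤ grid N (k + 1) then (1 : ℝ) else 0)))
        ≤ gamma1 N g / 8 * (cellSet N k).indicator 1 x := by
      by_cases h0 : k = 0
      · rw [if_pos h0, mul_zero]
        exact hcell
      · have hm : grid N k ≤ grid N (k + 1) := grid_mono N (Nat.le_succ k)
        have hle : ((if grid N k ≤ x.1 then (1 : ℝ) else 0) + if x.2 ≤ grid N k then (1 : ℝ) else 0)
          - ((if grid N (k + 1) ≤ x.1 then (1 : ℝ) else 0)
            + if x.2 ≤ grid N (k + 1) then (1 : ℝ) else 0)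
            ≤ (cellSet N k).indicator (1 : Prices → ℝ) x := by
          have b : (if x.2 ≤ grid N k then (1 : ℝ) else 0)
              ≤ if x.2 ≤ grid N (k + 1) then (1 : ℝ) else 0 := by
            by_cases c : (x.2 : ℝ) ≤ grid N k
            · simp [c, c.trans hm]
            · rw [if_neg c]
              split_ifs <;> simp
          by_cases c1 : grid N k ≤ x.1
          · by_cases c2 : grid N (k + 1) ≤ x.1
            · have : 0 ≤ (cellSet N k).indicator (1 : Prices → ℝ) x :=
                Set.indicator_nonneg (fun _ _ => zero_le_one) _
              rw [if_pos c1, if_pos c2]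
              linarith
            · have : x ∈ cellSet N k := ⟨h0, c1, not_le.1 c2⟩
              rw [if_pos c1, if_neg c2, Set.indicator_of_mem this, Pi.one_apply]
              linarith
          · have : 0 ≤ (cellSet N k).indicator (1 : Prices → ℝ) x :=
              Set.indicator_nonneg (fun _ _ => zero_le_one) _
            have c2 : ¬ grid N (k + 1) ≤ x.1 := fun c => c1 (hm.trans c)
            rw [if_neg c1, if_neg c2]
            linarith
        have := mul_le_mul_of_nonneg_left hle (show 0 ≤ gamma1 N g / 8 by linarith)
        rw [if_neg h0]
        linarith
    rw [bestGFT]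
    linarith

lemma gridCount_grid {N k : ℕ} (hk : k ≤ N) (hN : 0 < N) :
    gridCount N (grid N k) (grid N k) = N + 2 := by
  have hs : StrictMono (grid N) := by
    intro i j hij
    have h0 : (0 : ℝ) < N := by exact_mod_cast hN
    rw [grid_eq, grid_eq]
    gcongr
  have h : ∀ i ∈ Finset.range (N + 1), ((if grid N i ≤ grid N k then (1 : ℝ) else 0)
      + if grid N k ≤ grid N i then (1 : ℝ) else 0) = 1 + if k = i then 1 else 0 := by
    intro i _
    simp only [hs.le_iff_le]
    rcases lt_trichotomy i k with h | h | h
    · simp [h.le, h.not_ge, h.ne']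
    · simp [h]
    · simp [h.le, h.not_ge, h.ne]
  rw [gridCount, Finset.sum_congr rfl h, Finset.sum_add_distrib, Finset.sum_ite_eq,
    if_pos (by simp; omega)]
  simp
  ring

lemma le_iSup_expGFT {N k : ℕ} {g : ℝ} (hN : 0 < N) (hg : 0 ≤ g) (hg' : g ≤ 1 / 2) (hk : k < N) :
    bestGFT N g + (if k = 0 then 0 else gamma1 N g / 8)
      ≤ ⨆ p : unitInterval, expGFT (hardInstance hN hg hg' k) p p := by
  obtain ⟨C, hC⟩ := (bddMeas_expGFT (hardInstance hN hg hg' k)).bdd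
  have hb : BddAbove (Set.range fun p : unitInterval =>
      expGFT (hardInstance hN hg hg' k) p p) :=
    ⟨C, by rintro _ ⟨p, rfl⟩; exact (abs_le.1 (hC (p, p))).2⟩
  obtain ⟨h1, h2⟩ := grid_mem hN hk.le
  refine le_trans (le_of_eq ?_)
    (le_ciSup hb ⟨grid N k, by constructor <;> linarith⟩)
  have hlt : grid N k < grid N (k + 1) := by
    have h0 : (0 : ℝ) < N := by exact_mod_cast hN
    rw [grid_eq, grid_eq]
    gcongr
    exact Nat.lt_succ_self k
  simp only
  rw [expGFT_hardInstance, hardSum_gft hN _ _ _ h1 h2, gridCount_grid hk.le hN, sum_perturb hk,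
    bestGFT]
  have hne : ¬ (1 ≤ grid N k ∧ grid N k ≤ 0) := fun h => by linarith [h.1]
  by_cases h0 : k = 0
  · subst h0
    simp [hne]
  · simp only [h0, hne, if_false, le_refl, if_true, hlt.le, not_le.2 hlt]
    ring

/-! ### Regret lower bounds -/

section Regret

variable {Seed : Type*} [MeasurableSpace Seed] (A : Algorithm Seed) (ν : Measure Seed)

lemma Algorithm.regret_eq [IsProbabilityMeasure ν] (P : StochasticInstance) (T : ℕ) :
    A.regret ν P T = T * (⨆ p : unitInterval, expGFT P p p)
      - A.meanTotal ν P T fun x => expGFT P x.1 x.2 := by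
  have hp : IsProbabilityMeasure (interactionLaw ν P) := by
    unfold interactionLaw; infer_instance
  unfold Algorithm.regret Algorithm.pseudoRegret Algorithm.meanTotal
  rw [integral_sub (integrable_const _)
    (integrable_finsetSum _ fun t _ => (bddMeas_expGFT P).integrable A ν P t)]
  simp

lemma Algorithm.violation_eq (P : StochasticInstance) (T : ℕ) :
    A.violation ν P T = -A.meanTotal ν P T fun x => expRev P x.1 x.2 := by
  unfold Algorithm.violation Algorithm.pseudoViolation Algorithm.meanTotal
  rw [integral_neg]

/-- The Lagrangian bound summed over the horizon. -/
lemma Algorithm.le_regret_hardInstance [IsProbabilityMeasure ν] {N k : ℕ} {g : ℝ} (hN : 0 < N)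
    (hg : 0 ≤ g) (hg' : g ≤ 1 / 128) (hk : k < N) (T : ℕ) {V : ℝ} (hV0 : 0 ≤ V)
    (hV : A.violation ν (hardInstance hN hg (hg'.trans (by norm_num)) k) T ≤ V) :
    T * (if k = 0 then 0 else gamma1 N g / 8)
      + 1 / 32 * A.meanTotal ν (hardInstance hN hg (hg'.trans (by norm_num)) k) T
          (exploreSet.indicator 1)
      - gamma1 N g / 8 * A.meanTotal ν (hardInstance hN hg (hg'.trans (by norm_num)) k) T
          ((cellSet N k).indicator 1)
      - 3 * g * V
      ≤ A.regret ν (hardInstance hN hg (hg'.trans (by norm_num)) k) T := by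
  have h2 : g ≤ 1 / 2 := hg'.trans (by norm_num)
  have hsup := mul_le_mul_of_nonneg_left (le_iSup_expGFT hN hg h2 hk) (Nat.cast_nonneg' (α := ℝ) T)
  set P := hardInstance hN hg h2 k
  have b1 := bddMeas_expGFT P
  have b2 := (bddMeas_expRev P).const_mul (exchangeRate N g)
  have b3 := (bddMeas_indicator measurableSet_exploreSet).const_mul (1 / 32)
  have b4 := (bddMeas_indicator (measurableSet_cellSet N k)).const_mul (gamma1 N g / 8)
  have h := A.meanTotal_mono ν P T ((b1.add b2).add b3) ((bddMeas_const (bestGFT N g)).add b4)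
    fun x => expGFT_hardInstance_le hN hg hg' hk x
  rw [A.meanTotal_add ν P T (b1.add b2) b3, A.meanTotal_add ν P T b1 b2,
    A.meanTotal_add ν P T (bddMeas_const _) b4, A.meanTotal_const_mul, A.meanTotal_const_mul,
    A.meanTotal_const_mul, A.meanTotal_const] at h
  rw [A.violation_eq] at hV
  rw [A.regret_eq]
  have e1 := mul_le_mul_of_nonneg_left hV (exchangeRate_nonneg (N := N) hg h2)
  have e2 := mul_le_mul_of_nonneg_right (exchangeRate_le (N := N) hg h2) hV0
  linarith

/-- Some cell is rarely visited under its own instance, unless there is much exploration under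
`μ_0`: averaging over `k`. -/
lemma Algorithm.exists_meanTotal_cellSet_le [IsProbabilityMeasure ν] {N : ℕ} {g : ℝ} (hN : 10 ≤ N)
    (hg : 0 ≤ g) (hg' : g ≤ 1 / 4) (T : ℕ)
    (hM : 64 * (gamma1 N g / 3) ^ 2 * A.meanTotal ν
      (hardInstance (by omega : 0 < N) hg (hg'.trans (by norm_num)) 0) T
        (exploreSet.indicator 1) ≤ N / 8) :
    ∃ k, k ≠ 0 ∧ k < N ∧ A.meanTotal ν
      (hardInstance (by omega : 0 < N) hg (hg'.trans (by norm_num)) k) T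
        ((cellSet N k).indicator 1) ≤ T / 2 := by
  have hN0 : 0 < N := by omega
  have h2 : g ≤ 1 / 2 := hg'.trans (by norm_num)
  set P := hardInstance hN0 hg h2 0
  set κ := 64 * (gamma1 N g / 3) ^ 2
  have hκ : 0 ≤ κ := by positivity
  have hT : (0 : ℝ) ≤ T := Nat.cast_nonneg' T
  have s1 := A.sum_meanTotal_le ν P T (Finset.Ico 1 N)
    (fun k _ => bddMeas_indicator (measurableSet_cellSet N k)) (bddMeas_const 1)
    (sum_cellSet_le N)
  have s2 := A.sum_meanTotal_le ν P T (Finset.Ico 1 N)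
    (fun k _ => bddMeas_indicator (measurableSet_infoSet N k))
    (bddMeas_indicator measurableSet_exploreSet) (sum_infoSet_le N)
  rw [A.meanTotal_const, mul_one] at s1
  have hN10 : (10 : ℝ) ≤ N := by exact_mod_cast hN
  have hsum : ∑ k ∈ Finset.Ico 1 N, (2 * A.meanTotal ν P T ((cellSet N k).indicator 1)
      + 2 * κ * T * A.meanTotal ν P T ((infoSet N k).indicator 1))
      ≤ ∑ _k ∈ Finset.Ico 1 N, (T / 2 : ℝ) := by
    rw [Finset.sum_add_distrib, ← Finset.mul_sum, ← Finset.mul_sum, Finset.sum_const,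
      Nat.card_Ico, nsmul_eq_mul, Nat.cast_sub (by omega), Nat.cast_one]
    have s3 := mul_le_mul_of_nonneg_left s2 (show 0 ≤ 2 * κ * T by positivity)
    have s4 := mul_le_mul_of_nonneg_left hM (show 0 ≤ 2 * (T : ℝ) by positivity)
    nlinarith
  obtain ⟨k, hk, hle⟩ := Finset.exists_le_of_sum_le (by simp; omega) hsum
  rw [Finset.mem_Ico] at hk
  have hk0 : k ≠ 0 := by omega
  refine ⟨k, hk0, hk.2, le_trans ?_ hle⟩
  refine A.meanTotal_le_of_distinguishable ν T (distinguishable_hardInstance hN0 hg hg' hk.2 hk0)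
    (measurableSet_infoSet N k) (bddMeas_indicator (measurableSet_cellSet N k)).measurable
    fun x => ?_
  by_cases hx : x ∈ cellSet N k <;> simp [hx]

/-- The lower bound with the powers of `T` abstracted: `Y`, `G`, `V` and `X` stand for
`T ^ (1 - β)`, `T ^ (1 - 4 β / 3)`, `T ^ β` and `T ^ (1 - β / 3)`. -/
lemma Algorithm.exists_le_regret_hardInstance [IsProbabilityMeasure ν] {N : ℕ} {Y G V X : ℝ}
    (hN : 16 ≤ N) (hNY : N ≤ Y / 1024) (hYN : Y / 1024 < N + 1) (hG : 0 < G)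
    (hV : 0 ≤ V) (hX : 0 < X) (hGV : G * V = X) {T : ℕ} (hTG : T * G = X * Y)
    (hGX : G ^ 2 * X = Y ^ 3) (hg : 0 ≤ G / 2 ^ 14) (hg' : G / 2 ^ 14 ≤ 1 / 128)
    (hA : ∀ P : StochasticInstance, A.violation ν P T ≤ V) :
    ∃ k : Fin N, 1 / 2 ^ 14 * X
      ≤ A.regret ν (hardInstance (by omega : 0 < N) hg (hg'.trans (by norm_num)) k) T := by
  have hN0 : 0 < N := by omega
  have h2 : G / 2 ^ 14 ≤ 1 / 2 := hg'.trans (by norm_num)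
  have hNr : (16 : ℝ) ≤ N := by exact_mod_cast hN
  set γ := gamma1 N (G / 2 ^ 14) with hγ
  have hγe : γ * (2 ^ 16 * (N + 1)) = G := by
    rw [hγ, gamma1]
    field_simp
    norm_num
  have hγ0 : 0 ≤ γ := gamma1_nonneg hg
  set M := A.meanTotal ν (hardInstance hN0 hg h2 0) T (exploreSet.indicator 1) with hMdef
  -- If there is little exploration under `μ_0`, the bound `γ² X ≤ (N + 1) / 4` makes the `χ²` budget
  -- small enough to average over `k`.
  by_cases hM : X / 2 ^ 7 ≤ M
  · refine ⟨⟨0, hN0⟩, ?_⟩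
    have h := A.le_regret_hardInstance ν hN0 hg hg' hN0 T hV (hA _)
    have hcell : (cellSet N 0).indicator (1 : Prices → ℝ) = fun _ => 0 := by
      funext x
      exact Set.indicator_of_notMem (fun hx => hx.1 rfl) _
    rw [hcell, A.meanTotal_const, if_pos rfl, ← hMdef] at h
    have e : 3 * (G / 2 ^ 14) * V = 3 * X / 2 ^ 14 := by rw [← hGV]; ring
    rw [e] at h
    refine le_trans ?_ h
    linarith
  · have hγX : γ ^ 2 * X ≤ (N + 1) / 4 := by
      have h1 : γ ^ 2 * X * (2 ^ 32 * (N + 1) ^ 2) = Y ^ 3 := by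
        rw [← hGX, ← hγe]; ring
      have h3 : Y ^ 3 ≤ (1024 * (N + 1)) ^ 3 :=
        pow_le_pow_left₀ (by linarith) (by linarith) 3
      refine le_of_mul_le_mul_right ?_ (show (0 : ℝ) < 2 ^ 32 * (N + 1) ^ 2 by positivity)
      rw [h1]
      refine h3.trans (le_of_eq ?_)
      ring
    obtain ⟨k, hk0, hk, hle⟩ := A.exists_meanTotal_cellSet_le ν (by omega : 10 ≤ N) hg
      (hg'.trans (by norm_num)) T (by
        rw [← hMdef, ← hγ]
        have h4 := mul_le_mul_of_nonneg_left (not_le.1 hM).le (sq_nonneg γ)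
        nlinarith)
    refine ⟨⟨k, hk⟩, ?_⟩
    have h := A.le_regret_hardInstance ν hN0 hg hg' hk T hV (hA _)
    have e : 3 * (G / 2 ^ 14) * V = 3 * X / 2 ^ 14 := by rw [← hGV]; ring
    rw [if_neg hk0, e, ← hγ] at h
    have hexp : 0 ≤ A.meanTotal ν (hardInstance hN0 hg h2 k) T (exploreSet.indicator 1) :=
      integral_nonneg fun ω => Finset.sum_nonneg fun t _ =>
        Set.indicator_nonneg (fun _ _ => zero_le_one) _
    have hγT : X / 128 ≤ γ * T := by
      have h1 : γ * T * (2 ^ 16 * (N + 1)) = X * Y := by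
        rw [← hTG, ← hγe]; ring
      refine le_of_mul_le_mul_right ?_ (show (0 : ℝ) < 2 ^ 16 * (N + 1) by positivity)
      rw [h1]
      nlinarith
    have h5 := mul_le_mul_of_nonneg_left hle (show 0 ≤ γ / 8 by linarith)
    refine le_trans ?_ h
    linarith

end Regret

end BilateralTrade

end

open BilateralTrade in
theorem mainTheorem2 :
    ∃ c aN ag : ℝ, 0 < c ∧ 0 < aN ∧ 0 < ag ∧ ∃ T₀ : ℕ,
      ∀ β : ℝ, 3 / 4 ≤ β → β ≤ 6 / 7 →
      ∀ T : ℕ, T₀ ≤ T →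
      ∀ (N : ℕ) (g ε : ℝ),
        N = ⌊aN * (T : ℝ) ^ (1 - β)⌋₊ →
        g = ag * (T : ℝ) ^ (1 - 4 / 3 * β) →
        ε = gamma1 N g / 3 →
        2 ≤ N ∧ 0 < ε ∧
        ∃ μ : Fin N → StochasticInstance,
          (∀ k, (μ k).law = hardLaw N g ε k) ∧
          ∀ (Seed : Type*) [MeasurableSpace Seed]
            (ν : MeasureTheory.Measure Seed) [MeasureTheory.IsProbabilityMeasure ν]
            (A : Algorithm Seed),
            (∀ P : StochasticInstance, A.violation ν P T ≤ (T : ℝ) ^ β) →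
            ∃ k : Fin N, c * (T : ℝ) ^ (1 - β / 3) ≤ A.regret ν (μ k) T := by
  -- `aN` is small enough for `γ₁ T / 16` to exceed the value `3 g T ^ β` of the budget violation, and
  -- `ag ^ 3` is small compared with `aN ^ 3`, so that exploration at a cost of order `ag` does not
  -- reveal the instance. The bound on `T` ensures `N ≥ 16`.
  refine ⟨1 / 2 ^ 14, 1 / 1024, 1 / 2 ^ 14, by norm_num, by norm_num, by norm_num,
    (2 ^ 14) ^ 7, fun β hβ hβ' T hT N g ε hN hg hε => ?_⟩
  have hTr : ((2 : ℝ) ^ 14) ^ 7 ≤ T := by exact_mod_cast hT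
  have hT1 : (1 : ℝ) ≤ T := le_trans (by norm_num) hTr
  have hT0 : (0 : ℝ) < T := by linarith
  have hY : (2 : ℝ) ^ 14 ≤ (T : ℝ) ^ (1 - β) := by
    calc (2 : ℝ) ^ 14 = (((2 : ℝ) ^ 14) ^ 7) ^ (((7 : ℕ) : ℝ)⁻¹) :=
          (Real.pow_rpow_inv_natCast (by positivity) (by norm_num)).symm
      _ ≤ (T : ℝ) ^ (((7 : ℕ) : ℝ)⁻¹) :=
          Real.rpow_le_rpow (by positivity) hTr (by positivity)
      _ ≤ (T : ℝ) ^ (1 - β) := Real.rpow_le_rpow_of_exponent_le hT1 (by norm_num; linarith)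
  have hG1 : (T : ℝ) ^ (1 - 4 / 3 * β) ≤ 1 := Real.rpow_le_one_of_one_le_of_nonpos hT1 (by linarith)
  have hG0 : 0 < (T : ℝ) ^ (1 - 4 / 3 * β) := Real.rpow_pos_of_pos hT0 _
  have hV0 : 0 < (T : ℝ) ^ β := Real.rpow_pos_of_pos hT0 _
  have hX0 : 0 < (T : ℝ) ^ (1 - β / 3) := Real.rpow_pos_of_pos hT0 _
  have hGV : (T : ℝ) ^ (1 - 4 / 3 * β) * (T : ℝ) ^ β = (T : ℝ) ^ (1 - β / 3) := by
    rw [← Real.rpow_add hT0]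
    ring_nf
  have hTG : T * (T : ℝ) ^ (1 - 4 / 3 * β) = (T : ℝ) ^ (1 - β / 3) * (T : ℝ) ^ (1 - β) := by
    rw [← Real.rpow_add hT0]
    nth_rewrite 1 [← Real.rpow_one (T : ℝ)]
    rw [← Real.rpow_add hT0]
    ring_nf
  have hGX : ((T : ℝ) ^ (1 - 4 / 3 * β)) ^ 2 * (T : ℝ) ^ (1 - β / 3)
      = ((T : ℝ) ^ (1 - β)) ^ 3 := by
    rw [← Real.rpow_mul_natCast hT0.le, ← Real.rpow_mul_natCast hT0.le, ← Real.rpow_add hT0]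
    push_cast
    ring_nf
  generalize (T : ℝ) ^ (1 - β) = Y at *
  generalize (T : ℝ) ^ (1 - 4 / 3 * β) = G at *
  generalize (T : ℝ) ^ β = V at *
  generalize (T : ℝ) ^ (1 - β / 3) = X at *
  have hNY : (N : ℝ) ≤ Y / 1024 := by
    rw [hN]
    exact (Nat.floor_le (by linarith)).trans (by linarith)
  have hYN : Y / 1024 < N + 1 := by
    rw [hN]
    exact lt_of_le_of_lt (by linarith) (Nat.lt_floor_add_one _)
  have hN16 : 16 ≤ N := by
    rw [hN]
    exact Nat.le_floor (by norm_num; linarith)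
  have hN0 : 0 < N := by omega
  have hgG : g = G / 2 ^ 14 := by rw [hg]; ring
  have hg0 : 0 ≤ G / 2 ^ 14 := by positivity
  have hg128 : G / 2 ^ 14 ≤ 1 / 128 := by linarith
  subst hgG hε
  refine ⟨by omega, ?_, fun k => hardInstance hN0 hg0 (hg128.trans (by norm_num)) k,
    fun k => rfl, ?_⟩
  · unfold gamma1
    positivity
  · intro Seed _ ν _ A hA
    exact A.exists_le_regret_hardInstance ν hN16 hNY hYN hG0 hV0.le hX0 hGV hTG hGX hg0 hg128 hA
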